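/- Consider a single service whose requests arrive according to a Poisson process of rate $\lambda>0$ and whose delivery times are independent and exponential with rate $\mu>0$. The state is the number $S(t)\in\{0,1,2,\dots\}$ of outstanding requests, and the action is $A(t)\in\{0,1\}$ ($1$ active, i.e. placed at the edge; $0$ passive). Actions are chosen at event times (arrivals and deliveries) as a function of the past and kept until the next event. In state $s$ under action $a$, the state increases by one at rate $\lambda$ and decreases by one at rate $\mu s a$. Let $C(s)=s/\lambda$. For $W\in\mathbb R$, the single-service problem is to minimize over all history-dependent policies $\pi$ the average cost $$\bar C_\pi=\limsup_{T\to\infty}\frac1T\,\mathbb E_\pi\int_0^T\bigl(C(S(t))-W(1-A(t))\bigr)\,dt .$$ A stationary policy is called optimal if, from every initial state, its average cost equals the minimum $f$ (the same for all initial states) and its action realizes, in every state $s$, the minimum in the dynamic programming equation $$f=\min_{a\in\{0,1\}}\bigl[C(s)-W(1-a)+\lambda\bigl(V(s+1)-V(s)\bigr)+\mu s a\bigl(V(s-1)-V(s)\bigr)\bigr],\qquad s\ge 0,$$ for some solution $V$. Let $D(W)$ be the set of states in which some optimal stationary policy is passive. The problem is indexable if $D(W')\subseteq D(W)$ whenever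 $W'\le W$, and the Whittle index of state $s$ is then $W(s)=\inf\{W\ge 0: s\in D(W)\}$. For $R=0,1,2,\dots$ let the threshold policy $R$ be passive in the states $s<R$ and active in the states $s\ge R$. Proposition. For every $R\ge 0$ the threshold policy $R$ has a unique stationary distribution $q^R$; its average cost $\mathbb E_R[C(S)]=\sum_{s}C(s)q^R(s)$ is finite, and its stationary passive probability $\sum_{s<R}q^R(s)$ is strictly increasing in $R$. If $$w(R):=\frac{\mathbb E_{R+1}[C(S)]-\mathbb E_R[C(S)]}{\sum_{s<R+1}q^{R+1}(s)-\sum_{s<R}q^{R}(s)}$$ is non-decreasing in $R\ge 0$, then the problem is indexable and, for every $R\ge0$, the set $\{W\ge 0: R\in D(W)\}$ is non-empty and the Whittle index is $W(R)=w(R)$. -/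

import Mathlib

open MeasureTheory ProbabilityTheory Filter

noncomputable section

namespace ServicePlacement

/-- A single service: requests arrive at rate `lam` (Poisson process), and each outstanding request
is delivered after an exponential time of rate `mu` while the service is placed at the edge. -/
structure Service where
  lam : ℝ
  mu : ℝ
  lam_pos : 0 < lam
  mu_pos : 0 < mu

/-- One step of the controlled queue: the time spent in the preceding state (`0` for the initial
step) and the state (number of outstanding requests) that is entered. -/
abbrev Step := ℝ × ℕ

/-- The steps `0, …, n`, i.e. all that has been observed when the `n`-th event has just occurred. -/
abbrev History (n : ℕ) := (i : Finset.Iic n) → Step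

/-- The present state at the end of a history. -/
def History.state {n : ℕ} (h : History n) : ℕ := (h ⟨n, Finset.mem_Iic.2 le_rfl⟩).2

/-- A (history-dependent) policy: after each event (arrival or delivery) it chooses, as a measurable
function of the observed history, an action that is kept until the next event.
`true` is the active action `a = 1`, `false` the passive action `a = 0`. -/
structure Policy where
  act : (n : ℕ) → History n → Bool
  measurable_act : ∀ n, Measurable (act n)

theorem measurable_state (n : ℕ) : Measurable (History.state (n := n)) :=
  measurable_snd.comp (measurable_pi_apply _)

/-- The stationary policy that uses action `α s` whenever the state is `s`. -/
def Policy.stationary (α : ℕ → Bool) : Policy where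
  act _ h := α h.state
  measurable_act n := (measurable_from_top (f := α)).comp (measurable_state n)

/-- The threshold policy `R`: passive in the states `s < R`, active in the states `s ≥ R`. -/
def threshold (R : ℕ) : ℕ → Bool := fun s => decide (R ≤ s)

namespace Service

variable (σ : Service)

/-- Instantaneous cost `C(s) = s / λ`. -/
def cost (s : ℕ) : ℝ := s / σ.lam

/-- Death rate `d(s, a) = μ s a`; the birth rate is `λ`. -/
def deathRate (s : ℕ) (a : Bool) : ℝ := if a then σ.mu * s else 0

/-- Cost rate of the single-service problem with subsidy `W` for passivity:
`C(s) - W (1 - a)`. -/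
def costRate (W : ℝ) (s : ℕ) (a : Bool) : ℝ := σ.cost s - if a then 0 else W

/-! ### The controlled birth-and-death process -/

/-- Total rate at which state `s` is left under action `a`. -/
def exitRate (s : ℕ) (a : Bool) : ℝ := σ.lam + σ.deathRate s a

theorem deathRate_nonneg (s : ℕ) (a : Bool) : 0 ≤ σ.deathRate s a := by
  have := σ.mu_pos
  unfold deathRate
  split_ifs <;> positivity

theorem exitRate_pos (s : ℕ) (a : Bool) : 0 < σ.exitRate s a :=
  add_pos_of_pos_of_nonneg σ.lam_pos (σ.deathRate_nonneg s a)

/-- Law of the next state: `s + 1` with probability `λ / (λ + d(s, a))`, and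
`s - 1` with probability `d(s, a) / (λ + d(s, a))`. -/
def nextState (s : ℕ) (a : Bool) : Measure ℕ :=
  ENNReal.ofReal (σ.lam / σ.exitRate s a) • Measure.dirac (s + 1)
    + ENNReal.ofReal (σ.deathRate s a / σ.exitRate s a) • Measure.dirac (s - 1)

instance (s : ℕ) (a : Bool) : IsProbabilityMeasure (σ.nextState s a) := by
  have h := σ.exitRate_pos s a
  constructor
  simp only [nextState, Measure.add_apply, Measure.smul_apply, measure_univ, smul_eq_mul, mul_one]
  rw [← ENNReal.ofReal_add (div_nonneg σ.lam_pos.le h.le)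
    (div_nonneg (σ.deathRate_nonneg s a) h.le), ← add_div, ← exitRate, div_self h.ne',
    ENNReal.ofReal_one]

instance (s : ℕ) (a : Bool) : IsProbabilityMeasure (expMeasure (σ.exitRate s a)) :=
  isProbabilityMeasure_expMeasure (σ.exitRate_pos s a)

/-- Joint law of sojourn time and next state, given the present state and action: the sojourn time
is exponential with the exit rate, and independent of the next state. -/
def stepKernel : Kernel (ℕ × Bool) Step :=
  Kernel.ofFunOfCountable fun p => (expMeasure (σ.exitRate p.1 p.2)).prod (σ.nextState p.1 p.2)

instance : IsMarkovKernel σ.stepKernel :=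
  ⟨fun p => inferInstanceAs
    (IsProbabilityMeasure ((expMeasure (σ.exitRate p.1 p.2)).prod (σ.nextState p.1 p.2)))⟩

/-- Law of the next step given the history, under the policy `π`. -/
def historyKernel (π : Policy) (n : ℕ) : Kernel (History n) Step :=
  σ.stepKernel.comap (fun h => (h.state, π.act n h))
    ((measurable_state n).prodMk (π.measurable_act n))

instance (π : Policy) (n : ℕ) : IsMarkovKernel (σ.historyKernel π n) :=
  inferInstanceAs (IsMarkovKernel (σ.stepKernel.comap _ _))

/-- Law of the whole trajectory started with `s₀` outstanding requests, under the policy `π`. -/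
def law (π : Policy) (s₀ : ℕ) : Measure (ℕ → Step) :=
  Kernel.traj (X := fun _ => Step) (σ.historyKernel π) 0 fun _ => (0, s₀)

end Service

/-- Time of the `n`-th event. -/
def eventTime (ω : ℕ → Step) (n : ℕ) : ℝ := ∑ k ∈ Finset.range n, (ω (k + 1)).1

/-- Number of events up to time `t` (almost surely, only finitely many events occur by time `t`). -/
def eventCount (ω : ℕ → Step) (t : ℝ) : ℕ := sSup {n | eventTime ω n ≤ t}

/-- The state `S(t)`. -/
def stateAt (ω : ℕ → Step) (t : ℝ) : ℕ := (ω (eventCount ω t)).2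

/-- The action `A(t)`. -/
def Policy.actionAt (π : Policy) (ω : ℕ → Step) (t : ℝ) : Bool :=
  π.act (eventCount ω t) fun i => ω i

namespace Service

variable (σ : Service)

/-- Long-run average cost
`limsup_{T → ∞} (1 / T) E_π ∫_0^T (C(S(t)) - W (1 - A(t))) dt` from the initial state `s₀`. -/
def avgCost (W : ℝ) (π : Policy) (s₀ : ℕ) : EReal :=
  limsup (fun T : ℝ =>
    ((T⁻¹ * ∫ ω, (∫ t in (0 : ℝ)..T, σ.costRate W (stateAt ω t) (π.actionAt ω t)) ∂(σ.law π s₀) : ℝ)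
      : EReal)) atTop

/-! ### Optimality, indexability and the Whittle index -/

/-- The expression minimised over the action `a` in the dynamic programming equation. -/
def bellman (W : ℝ) (V : ℕ → ℝ) (s : ℕ) (a : Bool) : ℝ :=
  σ.costRate W s a + σ.lam * V (s + 1) + σ.deathRate s a * V (s - 1)
    - (σ.lam + σ.deathRate s a) * V s

/-- The dynamic programming equation of the single-service problem. -/
def SolvesDP (W f : ℝ) (V : ℕ → ℝ) : Prop :=
  ∀ s, f = min (σ.bellman W V s false) (σ.bellman W V s true)

/-- The stationary policy `α` is optimal for subsidy `W`: from every initial state its average cost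
is minimal among all policies, and in every state (also in those visited only
finitely often) its action realises the minimum in the dynamic programming equation whose constant
is the minimal average cost. -/
def IsOptimal (W : ℝ) (α : ℕ → Bool) : Prop :=
  ∃ (f : ℝ) (V : ℕ → ℝ),
    (∀ s₀, σ.avgCost W (Policy.stationary α) s₀ = f ∧ ∀ π : Policy, f ≤ σ.avgCost W π s₀) ∧
    σ.SolvesDP W f V ∧ ∀ s, σ.bellman W V s (α s) = f

/-- `D(W)`: the states in which the passive action is optimal for subsidy `W`. -/
def passiveSet (W : ℝ) : Set ℕ := {s | ∃ α, σ.IsOptimal W α ∧ α s = false}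

/-- Indexability: `D(W') ⊆ D(W)` whenever `W' ≤ W`. -/
def Indexable : Prop := Monotone σ.passiveSet

/-- The Whittle index `W(s) = inf {W ≥ 0 : s ∈ D(W)}`. -/
def whittleIndex (s : ℕ) : ℝ := sInf {W : ℝ | 0 ≤ W ∧ s ∈ σ.passiveSet W}

/-! ### Stationary distributions -/

/-- `q` is a stationary distribution of the queue under the stationary policy `α`: a probability
distribution on `ℕ` satisfying the global balance equations (outflow = inflow in each state). -/
def IsStationary (α : ℕ → Bool) (q : ℕ → ℝ) : Prop :=
  (∀ s, 0 ≤ q s) ∧ HasSum q 1 ∧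
  ∀ s, (σ.lam + σ.deathRate s (α s)) * q s
    = (if s = 0 then 0 else σ.lam * q (s - 1))
      + σ.deathRate (s + 1) (α (s + 1)) * q (s + 1)

/-- Average cost `E_q[C(S)]` under the distribution `q`. -/
def meanCost (q : ℕ → ℝ) : ℝ := ∑' s, σ.cost s * q s

/-- Probability under `q` of the states `s < R`, in which the threshold policy `R` is passive. -/
def _root_.ServicePlacement.passiveProb (q : ℕ → ℝ) (R : ℕ) : ℝ := ∑ s ∈ Finset.range R, q s

/-- `(E_{R+1}[C] - E_R[C]) / (P_{R+1}(passive) - P_R(passive))`, where `q R` is the stationary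
distribution of the threshold policy `R`. -/
def indexRatio (q : ℕ → ℕ → ℝ) (R : ℕ) : ℝ :=
  (σ.meanCost (q (R + 1)) - σ.meanCost (q R))
    / (passiveProb (q (R + 1)) (R + 1) - passiveProb (q R) R)

end Service

end ServicePlacement

end

/-!
The proof combines a closed form for the threshold policies with a verification theorem.

*Threshold policies.* Detailed balance (`isStationary_iff_detailed`) shows that the stationary
distribution of the threshold policy `R ≥ 1` is the Poisson distribution with mean `λ / μ`
conditioned on the states from `R - 1` on; `R = 0` has the same one as `R = 1`. The passive
probability is `P_0 = 0` and, for `R ≥ 1`, the mass `P_R` of the single state `R - 1`. It increases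
strictly, satisfies a recursion (`passive_rec`), and gives the cost
`E_R = ((R - 1) P_R + λ / μ) / λ`. Since `E_R` is unbounded and `P_R ≤ 1`, the ratios `w(R)` are
unbounded (`exists_lt_ratio`), and `w(0) = 0`. When `w` is non-decreasing, the Lagrangian cost
`E_R - W P_R` decreases up to the first `R` with `w(R) > W` and increases strictly afterwards.

*Dynamic programming.* With the constant `f` given, the equation determines the gains
`μ s (V(s) - V(s - 1))` recursively (`solvesDP_iff`), and passivity attains the minimum in `s` if
and only if the gain is at most `W`. For `f` the minimal Lagrangian cost, attained at `R`, the gain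
in `s ≥ R` is `(E_{s+1} - f) / P_{s+1}`, which exceeds `W` precisely because the threshold policy
`s + 1` costs more than `f` (`gain_eq`). In the states `s < R` the gain is at most `W` because the
Lagrangian cost decreases up to `R` (`gain_le`). So the threshold policy `R` solves the equation.

*Verification.* The number of events up to a time has a finite mean under every policy, as every
delivery is preceded by an arrival or by one of the initial requests (`integral_jumpSum_one_le`).
This excludes explosion and yields Dynkin's formula for functions with bounded increments
(`dynkin`) as the limit of the compensator identities of the single steps (`integral_jump`). The
relative value has bounded increments and is bounded below, so the threshold policy costs at most
`f` (`avgCost_stationary_le`). A policy that costs less than `f` would have a mean queue length of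
linear growth; the second moment inequality `sq_integral_stateAt_le` then makes its cost quadratic
in time, a contradiction (`le_avgCost`).

Hence the passive set is `{s | w(s) ≤ W}` (`passiveSet_eq`), from which indexability and the value
of the Whittle index can be read off.
-/

noncomputable section

namespace ServicePlacement

/-! ### The exponential sojourn time -/

theorem expMeasure_ae_nonneg (r : ℝ) : ∀ᵐ x ∂(expMeasure r), 0 ≤ x := by
  rw [expMeasure, gammaMeasure, ae_withDensity_iff
    (show Measurable (gammaPDF 1 r) from (measurable_gammaPDFReal 1 r).ennreal_ofReal)]
  refine .of_forall fun x hx => ?_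
  by_contra h
  exact hx (gammaPDF_of_neg (not_le.1 h))

theorem expMeasure_real_Iic {r : ℝ} (hr : 0 < r) {u : ℝ} (hu : 0 ≤ u) :
    (expMeasure r).real (Set.Iic u) = 1 - Real.exp (-(r * u)) := by
  have := isProbabilityMeasure_expMeasure hr
  rw [← cdf_eq_real, cdf_expMeasure_eq hr, if_pos hu]

theorem integral_min_expMeasure {r : ℝ} (hr : 0 < r) {u : ℝ} (hu : 0 ≤ u) :
    r * ∫ x, min x u ∂(expMeasure r) = (expMeasure r).real (Set.Iic u) := by
  have := isProbabilityMeasure_expMeasure hr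
  have hint : Integrable (fun x => min x u) (expMeasure r) := by
    refine Integrable.of_bound (by fun_prop) u ?_
    filter_upwards [expMeasure_ae_nonneg r] with x hx
    rw [Real.norm_of_nonneg (le_min hx hu)]
    exact min_le_right _ _
  have hnn : 0 ≤ᵐ[expMeasure r] fun x => min x u := by
    filter_upwards [expMeasure_ae_nonneg r] with x hx using le_min hx hu
  rw [hint.integral_eq_integral_meas_lt hnn]
  have key : ∀ t ∈ Set.Ioi (0 : ℝ), (expMeasure r).real {a | t < min a u}
      = (Set.Iio u).indicator (fun t => Real.exp (-(r * t))) t := by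
    intro t ht
    by_cases htu : t < u
    · rw [Set.indicator_of_mem (show t ∈ Set.Iio u from htu)]
      have : {a | t < min a u} = (Set.Iic t)ᶜ := by
        ext a; simp [htu]
      rw [this, probReal_compl_eq_one_sub measurableSet_Iic,
        expMeasure_real_Iic hr (le_of_lt ht)]
      ring
    · rw [Set.indicator_of_notMem (show t ∉ Set.Iio u from htu)]
      have : {a | t < min a u} = ∅ := by
        ext a; simp [htu]
      rw [this, measureReal_empty]
  rw [setIntegral_congr_fun measurableSet_Ioi key, setIntegral_indicator measurableSet_Iio,
    Set.Ioi_inter_Iio, ← integral_Ioc_eq_integral_Ioo, ← intervalIntegral.integral_of_le hu,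
    expMeasure_real_Iic hr hu, ← intervalIntegral.integral_const_mul]
  rw [intervalIntegral.integral_eq_sub_of_hasDerivAt
    (f := fun a => -Real.exp (-(r * a))) (fun x _ => hasDerivAt_neg_exp_mul_exp)
    ((by fun_prop : Continuous fun x => r * Real.exp (-(r * x))).intervalIntegrable _ _)]
  simp
  ring

/-- An exponential time of rate `r` that starts at time `τ` spends a mean time
`P(it ends before T) / r` before the horizon `T`. -/
theorem integral_elapsed_expMeasure {r : ℝ} (hr : 0 < r) (τ T : ℝ) :
    r * ∫ x, (min (τ + x) T - min τ T) ∂(expMeasure r)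
      = (expMeasure r).real {x | τ + x ≤ T} := by
  have := isProbabilityMeasure_expMeasure hr
  rcases le_or_gt τ T with h | h
  · have h1 : {x | τ + x ≤ T} = Set.Iic (T - τ) := by
      ext x; simp only [Set.mem_ofPred_eq, Set.mem_Iic]; constructor <;> intro <;> linarith
    rw [h1, ← integral_min_expMeasure hr (sub_nonneg.2 h)]
    congr 2 with x
    rw [min_eq_left h, ← min_sub_sub_right]
    congr 1; ring
  · have h1 : ∫ x, (min (τ + x) T - min τ T) ∂(expMeasure r) = 0 := by
      refine integral_eq_zero_of_ae ?_
      filter_upwards [expMeasure_ae_nonneg r] with x hx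
      rw [min_eq_right h.le, min_eq_right (by linarith)]
      simp
    have h2 : (expMeasure r) {x | τ + x ≤ T} = 0 := by
      refine measure_mono_null (t := {x | ¬ 0 ≤ x}) (fun x hx => ?_) (expMeasure_ae_nonneg r)
      simp only [Set.mem_ofPred_eq] at hx ⊢
      linarith
    rw [h1, measureReal_def, h2]
    simp

/-! ### One step of the controlled chain -/

/-- The trajectory that follows a history, padded with `(0, 0)` after its last event. -/
def History.extend {n : ℕ} (h : History n) (k : ℕ) : Step :=
  if hk : k ∈ Finset.Iic n then h ⟨k, hk⟩ else (0, 0)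

/-- The time of the last event of a history. -/
def History.time {n : ℕ} (h : History n) : ℝ := eventTime h.extend n

theorem measurable_eventTime (n : ℕ) : Measurable fun ω : ℕ → Step => eventTime ω n := by
  unfold eventTime
  fun_prop

theorem History.measurable_extend (n : ℕ) : Measurable (History.extend (n := n)) := by
  refine measurable_pi_lambda _ fun k => ?_
  unfold History.extend
  split_ifs
  · exact measurable_pi_apply _
  · exact measurable_const

theorem History.measurable_time (n : ℕ) : Measurable (History.time (n := n)) :=
  (measurable_eventTime n).comp (measurable_extend n)

theorem History.time_frestrictLe (ω : ℕ → Step) (n : ℕ) :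
    History.time (Preorder.frestrictLe (π := fun _ => Step) n ω : History n) = eventTime ω n := by
  unfold History.time eventTime
  refine Finset.sum_congr rfl fun k hk => ?_
  simp [History.extend, Nat.succ_le_of_lt (Finset.mem_range.1 hk)]

theorem eventTime_succ (ω : ℕ → Step) (n : ℕ) :
    eventTime ω (n + 1) = eventTime ω n + (ω (n + 1)).1 :=
  Finset.sum_range_succ _ _

/-- The action chosen when the `n`-th event has occurred. -/
def Policy.actionAfter (π : Policy) (ω : ℕ → Step) (n : ℕ) : Bool := π.act n fun i => ω i

theorem Policy.measurable_actionAfter (π : Policy) (n : ℕ) :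
    Measurable fun ω : ℕ → Step => π.actionAfter ω n :=
  (π.measurable_act n).comp (by fun_prop)

namespace Service

variable (σ : Service) (π : Policy) (s₀ : ℕ)

instance : IsProbabilityMeasure (σ.law π s₀) :=
  inferInstanceAs (IsProbabilityMeasure (Kernel.traj (X := fun _ => Step)
    (σ.historyKernel π) 0 fun _ => (0, s₀)))

/-- The joint law of the first `n` events and the next one disintegrates along the history
kernel. -/
theorem map_law_eq_compProd (n : ℕ) :
    (σ.law π s₀).map (fun ω => ((fun i => ω i : History n), ω (n + 1)))
      = ((σ.law π s₀).map (fun ω => (fun i => ω i : History n))) ⊗ₘ σ.historyKernel π n := by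
  have h1 := Kernel.traj_map_frestrictLe_apply (X := fun _ => Step) (κ := σ.historyKernel π) 0 n
    (fun _ => (0, s₀))
  have h2 := Kernel.partialTraj_compProd_eq_map_traj (X := fun _ => Step)
    (κ := σ.historyKernel π) (Nat.zero_le n) (x₀ := fun _ => (0, s₀))
  rw [← h1] at h2
  exact h2.symm

theorem integral_law_step (n : ℕ) {f : History n × Step → ℝ} (hf : Measurable f)
    (hi : Integrable (fun ω => f (fun i => ω i, ω (n + 1))) (σ.law π s₀)) :
    ∫ ω, f (fun i => ω i, ω (n + 1)) ∂(σ.law π s₀)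
      = ∫ ω, (∫ x, f (fun i => ω i, x) ∂(σ.stepKernel ((ω n).2, π.actionAfter ω n)))
          ∂(σ.law π s₀) := by
  have hm : Measurable fun ω : ℕ → Step => ((fun i => ω i : History n), ω (n + 1)) := by fun_prop
  have hm' : Measurable fun ω : ℕ → Step => (fun i => ω i : History n) := by fun_prop
  have hi' : Integrable f ((σ.law π s₀).map
      (fun ω => ((fun i => ω i : History n), ω (n + 1)))) :=
    (integrable_map_measure hf.aestronglyMeasurable hm.aemeasurable).2 hi
  rw [← integral_map (f := f) hm.aemeasurable hf.aestronglyMeasurable, map_law_eq_compProd,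
    Measure.integral_compProd (by rwa [← map_law_eq_compProd]), integral_map hm'.aemeasurable]
  · rfl
  · exact (hf.stronglyMeasurable.integral_kernel_prod_right' (κ := σ.historyKernel π n)
      ).aestronglyMeasurable

theorem ae_law_step (n : ℕ) {p : History n × Step → Prop} (hp : MeasurableSet {x | p x})
    (h : ∀ h : History n, ∀ᵐ x ∂(σ.stepKernel (h.state, π.act n h)), p (h, x)) :
    ∀ᵐ ω ∂(σ.law π s₀), p (fun i => ω i, ω (n + 1)) := by
  have hm : Measurable fun ω : ℕ → Step => ((fun i => ω i : History n), ω (n + 1)) := by fun_prop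
  have : ∀ᵐ x ∂((σ.law π s₀).map (fun ω => ((fun i => ω i : History n), ω (n + 1)))), p x := by
    rw [map_law_eq_compProd, Measure.ae_compProd_iff hp]
    exact .of_forall h
  exact ae_of_ae_map hm.aemeasurable this

theorem ae_law_zero : ∀ᵐ ω ∂(σ.law π s₀), ω 0 = (0, s₀) := by
  have h1 := Kernel.traj_map_frestrictLe_apply (X := fun _ => Step) (κ := σ.historyKernel π) 0 0
    (fun _ => (0, s₀))
  rw [Kernel.partialTraj_self, Kernel.id_apply] at h1
  have h2 : ∀ᵐ h ∂((σ.law π s₀).map (Preorder.frestrictLe (π := fun _ => Step) 0)),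
      h ⟨0, Finset.mem_Iic.2 le_rfl⟩ = ((0, s₀) : Step) := by
    rw [law, h1, ae_dirac_iff (measurableSet_eq_fun (measurable_pi_apply _) measurable_const)]
  exact ae_of_ae_map (by fun_prop) h2

theorem integral_nextState (φ : ℕ → ℝ) (s : ℕ) (a : Bool) :
    σ.exitRate s a * ∫ y, φ y ∂(σ.nextState s a)
      = σ.lam * φ (s + 1) + σ.deathRate s a * φ (s - 1) := by
  have hr := σ.exitRate_pos s a
  rw [nextState, integral_add_measure, integral_smul_measure, integral_smul_measure,
    integral_dirac, integral_dirac, ENNReal.toReal_ofReal (div_nonneg σ.lam_pos.le hr.le),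
    ENNReal.toReal_ofReal (div_nonneg (σ.deathRate_nonneg s a) hr.le)]
  · simp only [smul_eq_mul]
    field_simp
  · exact (integrable_dirac (by simp)).smul_measure (by simp)
  · exact (integrable_dirac (by simp)).smul_measure (by simp)

/-- The compensator identity for one sojourn that starts at time `τ`: both sides are the
probability that the sojourn ends by time `T`, times the mean of `φ` at the next state. -/
theorem integral_stepKernel (φ : ℕ → ℝ) (s : ℕ) (a : Bool) (τ T : ℝ) :
    ∫ x : Step, (if τ + x.1 ≤ T then φ x.2 else 0) ∂(σ.stepKernel (s, a))
      = ∫ x : Step, (σ.lam * φ (s + 1) + σ.deathRate s a * φ (s - 1))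
          * (min (τ + x.1) T - min τ T) ∂(σ.stepKernel (s, a)) := by
  have hr := σ.exitRate_pos s a
  have hk : σ.stepKernel (s, a) = (expMeasure (σ.exitRate s a)).prod (σ.nextState s a) := rfl
  have h1 : ∀ x : Step, (if τ + x.1 ≤ T then φ x.2 else 0)
      = {x : ℝ | τ + x ≤ T}.indicator 1 x.1 * φ x.2 := by
    intro x
    by_cases h : τ + x.1 ≤ T <;> simp [h]
  have h2 : ∀ x : Step, (σ.lam * φ (s + 1) + σ.deathRate s a * φ (s - 1))
          * (min (τ + x.1) T - min τ T) = (min (τ + x.1) T - min τ T)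
            * (fun _ : ℕ => σ.lam * φ (s + 1) + σ.deathRate s a * φ (s - 1)) x.2 := by
    intro x; ring
  simp_rw [h1, h2, hk]
  rw [integral_prod_mul ({x : ℝ | τ + x ≤ T}.indicator 1) φ,
    integral_prod_mul (fun x => min (τ + x) T - min τ T)
      (fun _ : ℕ => σ.lam * φ (s + 1) + σ.deathRate s a * φ (s - 1)),
    integral_indicator_one (measurableSet_le (by fun_prop) measurable_const),
    ← integral_elapsed_expMeasure hr τ T]
  simp only [integral_const, probReal_univ, one_smul]
  rw [← integral_nextState]
  ring

/-! ### Regular trajectories -/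

/-- A trajectory from `s₀` along which time does not run backwards and arrivals come one by one. -/
def _root_.ServicePlacement.Regular (s₀ : ℕ) (ω : ℕ → Step) : Prop :=
  ω 0 = (0, s₀) ∧ ∀ n, 0 ≤ (ω (n + 1)).1 ∧ (ω (n + 1)).2 ≤ (ω n).2 + 1

theorem ae_regular : ∀ᵐ ω ∂(σ.law π s₀), Regular s₀ ω := by
  refine (σ.ae_law_zero π s₀).and (ae_all_iff.2 fun n => ?_)
  refine σ.ae_law_step π s₀ n (p := fun x => 0 ≤ x.2.1 ∧ x.2.2 ≤ x.1.state + 1) ?_ fun h => ?_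
  · have h1 : Measurable fun x : History n × Step => x.2.1 := by fun_prop
    have h2 : Measurable fun x : History n × Step => x.2.2 := by fun_prop
    have h3 : Measurable fun x : History n × Step => x.1.state + 1 :=
      ((measurable_from_top (f := fun s : ℕ => s + 1)).comp
        (measurable_state n)).comp measurable_fst
    exact (measurableSet_le measurable_const h1).inter (measurableSet_le h2 h3)
  · have hk : σ.stepKernel (h.state, π.act n h)
      = (expMeasure (σ.exitRate h.state (π.act n h))).prod
          (σ.nextState h.state (π.act n h)) := rfl
    have h2 : ∀ᵐ y ∂(σ.nextState h.state (π.act n h)), y ≤ h.state + 1 := by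
      rw [nextState, ae_add_measure_iff]
      constructor <;> refine Measure.ae_smul_measure ?_ _
      · rw [ae_dirac_iff (Set.to_countable _).measurableSet]
      · rw [ae_dirac_iff (Set.to_countable _).measurableSet]
        omega
    rw [hk]
    filter_upwards [Measure.quasiMeasurePreserving_fst.ae (expMeasure_ae_nonneg _),
      Measure.quasiMeasurePreserving_snd.ae h2] with x hx hy
    exact ⟨hx, hy⟩

end Service

/-! ### Functionals of a trajectory up to a time horizon -/

/-- The time that a trajectory spends before the horizon `T` between the events `k` and `k + 1`. -/
def elapsed (T : ℝ) (ω : ℕ → Step) (k : ℕ) : ℝ :=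
  min (eventTime ω (k + 1)) T - min (eventTime ω k) T

/-- The sum of `φ s s'` over those of the first `n` transitions `s → s'` that occur by time `T`. -/
def jumpSum (φ : ℕ → ℕ → ℝ) (T : ℝ) (ω : ℕ → Step) (n : ℕ) : ℝ :=
  ∑ k ∈ Finset.range n, if eventTime ω (k + 1) ≤ T then φ (ω k).2 (ω (k + 1)).2 else 0

/-- The integral of `F` over the time up to the horizon `T` or the `n`-th event, whichever comes
first. -/
def timeSum (π : Policy) (F : ℕ → Bool → ℝ) (T : ℝ) (ω : ℕ → Step) (n : ℕ) : ℝ :=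
  ∑ k ∈ Finset.range n, F (ω k).2 (π.actionAfter ω k) * elapsed T ω k

namespace Regular

variable {s₀ : ℕ} {ω : ℕ → Step}

theorem state_le (h : Regular s₀ ω) (n : ℕ) : (ω n).2 ≤ s₀ + n := by
  induction n with
  | zero => simp [h.1]
  | succ n ih => have := (h.2 n).2; omega

theorem monotone_eventTime (h : Regular s₀ ω) : Monotone (eventTime ω) :=
  monotone_nat_of_le_succ fun n => by
    rw [eventTime_succ]; linarith [(h.2 n).1]

theorem elapsed_nonneg (h : Regular s₀ ω) (T : ℝ) (k : ℕ) : 0 ≤ elapsed T ω k :=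
  sub_nonneg.2 (min_le_min_right _ (h.monotone_eventTime k.le_succ))

theorem _root_.ServicePlacement.sum_elapsed_le (ω : ℕ → Step) {T : ℝ} (hT : 0 ≤ T) (n : ℕ) :
    ∑ k ∈ Finset.range n, elapsed T ω k ≤ T := by
  unfold elapsed
  rw [Finset.sum_range_sub (fun k => min (eventTime ω k) T)]
  simp [eventTime, hT]

theorem elapsed_le (h : Regular s₀ ω) {T : ℝ} (hT : 0 ≤ T) (k : ℕ) : elapsed T ω k ≤ T := by
  refine le_trans ?_ (sum_elapsed_le ω hT (k + 1))
  rw [Finset.sum_range_succ]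
  linarith [Finset.sum_nonneg fun i (_ : i ∈ Finset.range k) => h.elapsed_nonneg T i]

/-- Among the first `n` events exactly the first `m` occur by time `T`, for some `m ≤ n`, so that
sums over the events up to `T` count or telescope to `m`. -/
theorem exists_count (h : Regular s₀ ω) {T : ℝ} (hT : 0 ≤ T) (n : ℕ) :
    ∃ m ≤ n, eventTime ω m ≤ T ∧ (m < n → T < eventTime ω (m + 1)) ∧
      jumpSum (fun _ _ => 1) T ω n = m ∧
      ∀ V : ℕ → ℝ, jumpSum (fun s s' => V s' - V s) T ω n = V (ω m).2 - V s₀ := by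
  induction n with
  | zero => exact ⟨0, le_rfl, by simpa [eventTime] using hT, by simp, by simp [jumpSum],
      fun V => by simp [jumpSum, h.1]⟩
  | succ n ih =>
    obtain ⟨m, hmn, h1, h2, h3, h4⟩ := ih
    unfold jumpSum at h3 h4 ⊢
    by_cases hc : eventTime ω (n + 1) ≤ T
    · have hm : m = n := by
        by_contra hne
        have h5 := h2 (lt_of_le_of_ne hmn hne)
        have h6 := h.monotone_eventTime (show m + 1 ≤ n + 1 by omega)
        linarith
      subst hm
      refine ⟨m + 1, le_rfl, hc, by omega, ?_, fun V => ?_⟩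
      · rw [Finset.sum_range_succ, h3, if_pos hc]; push_cast; ring
      · rw [Finset.sum_range_succ, h4, if_pos hc]; ring
    · refine ⟨m, by omega, h1, fun hm => ?_, ?_, fun V => ?_⟩
      · rcases hmn.lt_or_eq with h5 | rfl
        · exact h2 h5
        · exact not_le.1 hc
      · rw [Finset.sum_range_succ, h3, if_neg hc, add_zero]
      · rw [Finset.sum_range_succ, h4, if_neg hc, add_zero]

theorem eventCount_eq (h : Regular s₀ ω) {t : ℝ} {m : ℕ} (h1 : eventTime ω m ≤ t)
    (h2 : t < eventTime ω (m + 1)) :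
    eventCount ω t = m := by
  have : {n | eventTime ω n ≤ t} = Set.Iic m := by
    ext n
    simp only [Set.mem_ofPred_eq, Set.mem_Iic]
    constructor
    · intro hn
      by_contra hlt
      have := h.monotone_eventTime (show m + 1 ≤ n by omega)
      linarith
    · intro hn
      exact (h.monotone_eventTime hn).trans h1
  rw [eventCount, this, csSup_Iic]

/-- The process is constant between events, so time integrals are finite sums as soon as the
horizon is passed. -/
theorem intervalIntegral_eq_timeSum (h : Regular s₀ ω) (π : Policy) (F : ℕ → Bool → ℝ) {T : ℝ}
    (hT : 0 ≤ T) {n : ℕ} (hn : T < eventTime ω n) :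
    ∫ t in (0 : ℝ)..T, F (stateAt ω t) (π.actionAt ω t) = timeSum π F T ω n := by
  set a : ℕ → ℝ := fun k => min (eventTime ω k) T with ha
  have ha0 : a 0 = 0 := by simp [ha, eventTime, hT]
  have han : a n = T := min_eq_right hn.le
  have hmono : ∀ k, a k ≤ a (k + 1) := fun k =>
    min_le_min_right _ (h.monotone_eventTime k.le_succ)
  have hpiece : ∀ k, ∀ t ∈ Set.Ioo (a k) (a (k + 1)),
      F (stateAt ω t) (π.actionAt ω t) = F (ω k).2 (π.actionAfter ω k) := by
    intro k t ht
    have hcount : eventCount ω t = k := by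
      have h3 := lt_min_iff.1 ht.2
      refine h.eventCount_eq ?_ h3.1
      rcases min_lt_iff.1 ht.1 with h4 | h4
      · exact h4.le
      · exact absurd h3.2 (not_lt.2 h4.le)
    rw [stateAt, Policy.actionAt, hcount, Policy.actionAfter]
  have hae : ∀ k, (fun _ => F (ω k).2 (π.actionAfter ω k))
      =ᵐ[volume.restrict (Set.uIoc (a k) (a (k + 1)))]
        fun t => F (stateAt ω t) (π.actionAt ω t) := by
    intro k
    rw [Set.uIoc_of_le (hmono k), ← restrict_Ioo_eq_restrict_Ioc]
    filter_upwards [ae_restrict_mem measurableSet_Ioo] with t ht using (hpiece k t ht).symm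
  have hint : ∀ k < n, IntervalIntegrable
      (fun t => F (stateAt ω t) (π.actionAt ω t)) volume (a k) (a (k + 1)) := fun k _ =>
    (intervalIntegrable_const (c := F (ω k).2 (π.actionAfter ω k))).congr_ae (hae k)
  have hsum := intervalIntegral.sum_integral_adjacent_intervals hint
  rw [ha0, han] at hsum
  rw [← hsum, timeSum]
  refine Finset.sum_congr rfl fun k _ => ?_
  rw [← intervalIntegral.integral_congr_ae_restrict (hae k), intervalIntegral.integral_const,
    smul_eq_mul, mul_comm]
  rfl

/-- A functional of linear growth is controlled by the number of events up to the horizon, because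
the state exceeds `s₀` by at most that number. -/
theorem abs_timeSum_le (h : Regular s₀ ω) (π : Policy) {F : ℕ → Bool → ℝ} {C : ℝ}
    (hF : ∀ s a, |F s a| ≤ C * (s + 1)) {T : ℝ} (hT : 0 ≤ T) (n : ℕ) :
    |timeSum π F T ω n| ≤ C * (s₀ + jumpSum (fun _ _ => 1) T ω n + 1) * T := by
  have hC : 0 ≤ C := by simpa using (abs_nonneg _).trans (hF 0 true)
  obtain ⟨m, hmn, h1, h2, h3, -⟩ := h.exists_count hT n
  rw [h3]
  calc |timeSum π F T ω n|
      ≤ ∑ k ∈ Finset.range n, |F (ω k).2 (π.actionAfter ω k) * elapsed T ω k| :=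
        Finset.abs_sum_le_sum_abs _ _
    _ ≤ ∑ k ∈ Finset.range n, C * (s₀ + m + 1) * elapsed T ω k := by
        refine Finset.sum_le_sum fun k hk => ?_
        rw [abs_mul, abs_of_nonneg (h.elapsed_nonneg T k)]
        by_cases hkm : k ≤ m
        · refine mul_le_mul_of_nonneg_right ((hF _ _).trans ?_) (h.elapsed_nonneg T k)
          refine mul_le_mul_of_nonneg_left ?_ hC
          have : (ω k).2 ≤ s₀ + m := (h.state_le k).trans (by omega)
          have : ((ω k).2 : ℝ) ≤ s₀ + m := by exact_mod_cast this
          linarith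
        · have hkn := Finset.mem_range.1 hk
          have h5 := h2 (by omega)
          have h6 := h.monotone_eventTime (show m + 1 ≤ k by omega)
          have h7 := h.monotone_eventTime k.le_succ
          have : elapsed T ω k = 0 := by
            rw [elapsed, min_eq_right (by linarith), min_eq_right (by linarith), sub_self]
          rw [this]; simp
    _ ≤ C * (s₀ + m + 1) * T := by
        rw [← Finset.mul_sum]
        exact mul_le_mul_of_nonneg_left (sum_elapsed_le ω hT n) (by positivity)

end Regular

theorem monotone_jumpSum_one (T : ℝ) (ω : ℕ → Step) : Monotone (jumpSum (fun _ _ => 1) T ω) :=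
  monotone_nat_of_le_succ fun n => by
    rw [jumpSum, jumpSum, Finset.sum_range_succ]
    split_ifs <;> simp

theorem measurable_jumpSum (φ : ℕ → ℕ → ℝ) (T : ℝ) (n : ℕ) :
    Measurable fun ω => jumpSum φ T ω n := by
  unfold jumpSum
  refine Finset.measurable_sum _ fun k _ => ?_
  refine Measurable.ite (measurableSet_le (measurable_eventTime _) measurable_const) ?_
    measurable_const
  have : Measurable fun ω : ℕ → Step => ((ω k).2, (ω (k + 1)).2) := by fun_prop
  exact (Measurable.of_discrete (f := fun p : ℕ × ℕ => φ p.1 p.2)).comp this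

theorem measurable_elapsed (T : ℝ) (k : ℕ) : Measurable fun ω => elapsed T ω k :=
  ((measurable_eventTime _).min measurable_const).sub
    ((measurable_eventTime _).min measurable_const)

theorem measurable_apply_state_action (π : Policy) (F : ℕ → Bool → ℝ) (k : ℕ) :
    Measurable fun ω : ℕ → Step => F (ω k).2 (π.actionAfter ω k) := by
  have : Measurable fun ω : ℕ → Step => ((ω k).2, π.actionAfter ω k) :=
    Measurable.prodMk (by fun_prop) (π.measurable_actionAfter k)
  exact (Measurable.of_discrete (f := fun p : ℕ × Bool => F p.1 p.2)).comp this

namespace Service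

variable (σ : Service) (π : Policy) (s₀ : ℕ)

/-- The rate at which `φ` accumulates over the transitions out of the state `s` under the
action `a`. -/
def jumpRate (φ : ℕ → ℕ → ℝ) (s : ℕ) (a : Bool) : ℝ :=
  σ.lam * φ s (s + 1) + σ.deathRate s a * φ s (s - 1)

theorem integrable_jump (φ : ℕ → ℕ → ℝ) (T : ℝ) (k : ℕ) :
    Integrable (fun ω => if eventTime ω (k + 1) ≤ T then φ (ω k).2 (ω (k + 1)).2 else 0)
      (σ.law π s₀) := by
  refine Integrable.of_bound (C := ∑ i ∈ Finset.range (s₀ + k + 2),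
    ∑ j ∈ Finset.range (s₀ + k + 2), |φ i j|) ?_ ?_
  · refine ((measurable_jumpSum φ T (k + 1)).sub
      (measurable_jumpSum φ T k)).aestronglyMeasurable.congr (.of_forall fun ω => ?_)
    simp [jumpSum, Finset.sum_range_succ]
  · filter_upwards [σ.ae_regular π s₀] with ω h
    have h1 := h.state_le k
    have h2 := h.state_le (k + 1)
    have h3 : |φ (ω k).2 (ω (k + 1)).2| ≤ ∑ i ∈ Finset.range (s₀ + k + 2),
        ∑ j ∈ Finset.range (s₀ + k + 2), |φ i j| :=
      (Finset.single_le_sum (f := fun j => |φ (ω k).2 j|) (fun _ _ => abs_nonneg _)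
        (Finset.mem_range.2 (by omega : (ω (k + 1)).2 < s₀ + k + 2))).trans
      (Finset.single_le_sum (f := fun i => ∑ j ∈ Finset.range (s₀ + k + 2), |φ i j|)
        (fun _ _ => Finset.sum_nonneg fun _ _ => abs_nonneg _)
        (Finset.mem_range.2 (by omega : (ω k).2 < s₀ + k + 2)))
    split_ifs
    · exact h3
    · simpa using (abs_nonneg _).trans h3

theorem integrable_elapsed (F : ℕ → Bool → ℝ) {T : ℝ} (hT : 0 ≤ T) (k : ℕ) :
    Integrable (fun ω => F (ω k).2 (π.actionAfter ω k) * elapsed T ω k) (σ.law π s₀) := by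
  refine Integrable.of_bound (C := (∑ i ∈ Finset.range (s₀ + k + 1), ∑ a, |F i a|) * T) ?_ ?_
  · exact ((measurable_apply_state_action π F k).mul
      (measurable_elapsed T k)).aestronglyMeasurable
  · filter_upwards [σ.ae_regular π s₀] with ω h
    have h1 := h.state_le k
    rw [Real.norm_eq_abs, abs_mul, abs_of_nonneg (h.elapsed_nonneg T k)]
    refine mul_le_mul ?_ (h.elapsed_le hT k) (h.elapsed_nonneg T k)
      (Finset.sum_nonneg fun _ _ => Finset.sum_nonneg fun _ _ => abs_nonneg _)
    exact (Finset.single_le_sum (f := fun a => |F (ω k).2 a|) (fun _ _ => abs_nonneg _)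
        (Finset.mem_univ (π.actionAfter ω k))).trans
      (Finset.single_le_sum (f := fun i => ∑ a, |F i a|)
        (fun _ _ => Finset.sum_nonneg fun _ _ => abs_nonneg _)
        (Finset.mem_range.2 (by omega : (ω k).2 < s₀ + k + 1)))

/-- Transitions occur at their rates: the compensator identity for a single step. -/
theorem integral_jump (φ : ℕ → ℕ → ℝ) {T : ℝ} (hT : 0 ≤ T) (k : ℕ) :
    ∫ ω, (if eventTime ω (k + 1) ≤ T then φ (ω k).2 (ω (k + 1)).2 else 0) ∂(σ.law π s₀)
      = ∫ ω, σ.jumpRate φ (ω k).2 (π.actionAfter ω k) * elapsed T ω k ∂(σ.law π s₀) := by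
  have ht : Measurable fun p : History k × Step => p.1.time :=
    (History.measurable_time k).comp measurable_fst
  have hs : Measurable fun p : History k × Step => p.1.state :=
    (measurable_state k).comp measurable_fst
  have hx : Measurable fun p : History k × Step => p.2.1 := by fun_prop
  have hy : Measurable fun p : History k × Step => p.2.2 := by fun_prop
  have ha : Measurable fun p : History k × Step => π.act k p.1 :=
    (π.measurable_act k).comp measurable_fst
  let f : History k × Step → ℝ := fun p =>
    if p.1.time + p.2.1 ≤ T then φ p.1.state p.2.2 else 0
  have hf : Measurable f :=
    Measurable.ite (measurableSet_le (ht.add hx) measurable_const)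
      ((Measurable.of_discrete (f := fun p : ℕ × ℕ => φ p.1 p.2)).comp (hs.prodMk hy))
      measurable_const
  let g : History k × Step → ℝ := fun p =>
    σ.jumpRate φ p.1.state (π.act k p.1) * (min (p.1.time + p.2.1) T - min p.1.time T)
  have hg : Measurable g :=
    ((Measurable.of_discrete (f := fun p : ℕ × Bool => σ.jumpRate φ p.1 p.2)).comp
      (hs.prodMk ha)).mul (((ht.add hx).min measurable_const).sub (ht.min measurable_const))
  have htime : ∀ ω : ℕ → Step, History.time (fun i => ω i : History k) = eventTime ω k :=
    fun ω => History.time_frestrictLe ω k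
  have hfω : ∀ ω : ℕ → Step, f (fun i => ω i, ω (k + 1))
      = if eventTime ω (k + 1) ≤ T then φ (ω k).2 (ω (k + 1)).2 else 0 := fun ω => by
    simp only [f, htime, eventTime_succ]; rfl
  have hgω : ∀ ω : ℕ → Step, g (fun i => ω i, ω (k + 1))
      = σ.jumpRate φ (ω k).2 (π.actionAfter ω k) * elapsed T ω k := fun ω => by
    simp only [g, htime, elapsed, eventTime_succ]; rfl
  simp_rw [← hfω, ← hgω]
  rw [σ.integral_law_step π s₀ k hf (by simpa only [hfω] using σ.integrable_jump π s₀ φ T k),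
    σ.integral_law_step π s₀ k hg
      (by simpa only [hgω] using σ.integrable_elapsed π s₀ (σ.jumpRate φ) hT k)]
  congr with ω
  simp only [f, g, htime]
  exact σ.integral_stepKernel (φ (ω k).2) (ω k).2 (π.actionAfter ω k) (eventTime ω k) T

theorem integrable_jumpSum (φ : ℕ → ℕ → ℝ) (T : ℝ) (n : ℕ) :
    Integrable (fun ω => jumpSum φ T ω n) (σ.law π s₀) :=
  integrable_finsetSum _ fun k _ => σ.integrable_jump π s₀ φ T k

theorem integrable_timeSum (F : ℕ → Bool → ℝ) {T : ℝ} (hT : 0 ≤ T) (n : ℕ) :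
    Integrable (fun ω => timeSum π F T ω n) (σ.law π s₀) :=
  integrable_finsetSum _ fun k _ => σ.integrable_elapsed π s₀ F hT k

theorem integral_jumpSum (φ : ℕ → ℕ → ℝ) {T : ℝ} (hT : 0 ≤ T) (n : ℕ) :
    ∫ ω, jumpSum φ T ω n ∂(σ.law π s₀) = ∫ ω, timeSum π (σ.jumpRate φ) T ω n ∂(σ.law π s₀) := by
  unfold jumpSum timeSum
  rw [integral_finsetSum _ fun k _ => σ.integrable_jump π s₀ φ T k,
    integral_finsetSum _ fun k _ => σ.integrable_elapsed π s₀ _ hT k]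
  exact Finset.sum_congr rfl fun k _ => σ.integral_jump π s₀ φ hT k

end Service

/-! ### Passing to the limit of all events: Dynkin's formula -/

theorem Regular.jumpSum_eq {s₀ : ℕ} {ω : ℕ → Step} (h : Regular s₀ ω) {T : ℝ} (hT : 0 ≤ T) {n : ℕ}
    (hn : T < eventTime ω n) (V : ℕ → ℝ) :
    jumpSum (fun s s' => V s' - V s) T ω n = V (stateAt ω T) - V s₀ := by
  obtain ⟨m, hmn, h1, h2, -, h4⟩ := h.exists_count hT n
  have hlt : m < n := lt_of_le_of_ne hmn (by rintro rfl; linarith)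
  rw [h4, stateAt, h.eventCount_eq h1 (h2 hlt)]

namespace Service

variable (σ : Service) (π : Policy) (s₀ : ℕ)

/-- The mean number of events by time `T` is at most `2 λ T + s₀`, under every policy: arrivals
occur at the rate `λ`, and there are at most `s₀` more deliveries than arrivals. -/
theorem integral_jumpSum_one_le {T : ℝ} (hT : 0 ≤ T) (n : ℕ) :
    ∫ ω, jumpSum (fun _ _ => 1) T ω n ∂(σ.law π s₀) ≤ 2 * σ.lam * T + s₀ := by
  have hlam := σ.lam_pos
  -- `φ` counts arrivals twice and deliveries not at all.
  let φ : ℕ → ℕ → ℝ := fun s s' => 1 + ((s' : ℝ) - s)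
  have hφ : σ.jumpRate φ = fun _ _ => 2 * σ.lam := by
    ext s a
    rcases s with _ | s
    · simp [jumpRate, φ, deathRate]; ring
    · simp [jumpRate, φ]; ring
  have h1 : ∫ ω, jumpSum (fun _ _ => 1) T ω n ∂(σ.law π s₀)
      ≤ ∫ ω, (jumpSum φ T ω n + s₀) ∂(σ.law π s₀) := by
    refine integral_mono_ae (σ.integrable_jumpSum π s₀ _ T n)
      ((σ.integrable_jumpSum π s₀ _ T n).add (integrable_const _)) ?_
    filter_upwards [σ.ae_regular π s₀] with ω h
    obtain ⟨m, -, -, -, -, h4⟩ := h.exists_count hT n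
    have h5 := h4 (fun s => (s : ℝ))
    have h6 : jumpSum φ T ω n = jumpSum (fun _ _ => 1) T ω n
        + jumpSum (fun s s' => (s' : ℝ) - s) T ω n := by
      simp only [jumpSum, ← Finset.sum_add_distrib]
      refine Finset.sum_congr rfl fun k _ => ?_
      split_ifs <;> simp [φ]
    have h7 : (0 : ℝ) ≤ (ω m).2 := Nat.cast_nonneg _
    change jumpSum (fun _ _ => 1) T ω n ≤ jumpSum φ T ω n + s₀
    linarith
  have h2 : ∫ ω, timeSum π (fun _ _ => 2 * σ.lam) T ω n ∂(σ.law π s₀)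
      ≤ ∫ _, 2 * σ.lam * T ∂(σ.law π s₀) := by
    refine integral_mono_ae (σ.integrable_timeSum π s₀ _ hT n) (integrable_const _) ?_
    refine .of_forall fun ω => ?_
    simp only [timeSum, ← Finset.mul_sum]
    exact mul_le_mul_of_nonneg_left (sum_elapsed_le ω hT n) (by positivity)
  rw [integral_add (σ.integrable_jumpSum π s₀ _ T n) (integrable_const _), integral_jumpSum
    σ π s₀ φ hT, hφ] at h1
  simp only [integral_const, probReal_univ, one_smul] at h1 h2
  linarith

/-- The number of events up to `T` is integrable; it dominates all the limits below. -/
theorem exists_integrable_bound_jumpSum {T : ℝ} (hT : 0 ≤ T) :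
    ∃ g : (ℕ → Step) → ℝ, Integrable g (σ.law π s₀) ∧
      ∀ᵐ ω ∂(σ.law π s₀), ∀ n, jumpSum (fun _ _ => 1) T ω n ≤ g ω := by
  set f : (ℕ → Step) → ENNReal :=
    fun ω => ⨆ n, ENNReal.ofReal (jumpSum (fun _ _ => 1) T ω n) with hf
  have hmeas : ∀ n, Measurable fun ω => ENNReal.ofReal (jumpSum (fun _ _ => 1) T ω n) :=
    fun n => (measurable_jumpSum _ T n).ennreal_ofReal
  have hlt : ∫⁻ ω, f ω ∂(σ.law π s₀) ≠ ⊤ := by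
    rw [lintegral_iSup hmeas fun i j hij ω =>
      ENNReal.ofReal_le_ofReal (monotone_jumpSum_one T ω hij)]
    refine ne_top_of_le_ne_top (b := ENNReal.ofReal (2 * σ.lam * T + s₀)) ENNReal.ofReal_ne_top
      (iSup_le fun n => ?_)
    rw [← ofReal_integral_eq_lintegral_ofReal (σ.integrable_jumpSum π s₀ _ T n)]
    · exact ENNReal.ofReal_le_ofReal (σ.integral_jumpSum_one_le π s₀ hT n)
    · exact .of_forall fun ω => Finset.sum_nonneg fun k _ => by split_ifs <;> simp
  have hfm : AEMeasurable f (σ.law π s₀) := (Measurable.iSup hmeas).aemeasurable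
  refine ⟨fun ω => (f ω).toReal, integrable_toReal_of_lintegral_ne_top hfm hlt, ?_⟩
  filter_upwards [ae_lt_top' hfm hlt] with ω h n
  exact (ENNReal.ofReal_le_iff_le_toReal h.ne).1
    (le_iSup (fun n => ENNReal.ofReal (jumpSum (fun _ _ => 1) T ω n)) n)

/-- No explosion: almost surely only finitely many events occur by time `T`, so that the supremum
in `eventCount` is a maximum. -/
theorem ae_eventually_lt_eventTime {T : ℝ} (hT : 0 ≤ T) :
    ∀ᵐ ω ∂(σ.law π s₀), ∀ᶠ n in atTop, T < eventTime ω n := by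
  obtain ⟨g, -, hg⟩ := σ.exists_integrable_bound_jumpSum π s₀ hT
  filter_upwards [σ.ae_regular π s₀, hg] with ω h hω
  obtain ⟨N, hN⟩ := exists_nat_gt (g ω)
  obtain ⟨m, hmn, h1, h2, h3, -⟩ := h.exists_count hT N
  have h4 := hω N
  have h5 : (m : ℝ) < N := by linarith
  have h6 : m < N := by exact_mod_cast h5
  filter_upwards [eventually_ge_atTop (m + 1)] with n hn
  exact (h2 h6).trans_le (h.monotone_eventTime hn)

theorem tendsto_integral_of_eventually_eq {X : ℕ → (ℕ → Step) → ℝ} {Y g : (ℕ → Step) → ℝ}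
    (hX : ∀ n, Integrable (X n) (σ.law π s₀)) (hg : Integrable g (σ.law π s₀))
    (hb : ∀ᵐ ω ∂(σ.law π s₀), ∀ n, |X n ω| ≤ g ω)
    (hY : ∀ᵐ ω ∂(σ.law π s₀), ∀ᶠ n in atTop, X n ω = Y ω) :
    Integrable Y (σ.law π s₀) ∧
      Tendsto (fun n => ∫ ω, X n ω ∂(σ.law π s₀)) atTop (nhds (∫ ω, Y ω ∂(σ.law π s₀))) := by
  have hlim : ∀ᵐ ω ∂(σ.law π s₀), Tendsto (fun n => X n ω) atTop (nhds (Y ω)) := by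
    filter_upwards [hY] with ω h using tendsto_nhds_of_eventually_eq h
  constructor
  · refine hg.mono' (aestronglyMeasurable_of_tendsto_ae atTop
      (fun n => (hX n).aestronglyMeasurable) hlim) ?_
    filter_upwards [hb, hY] with ω h1 h2
    obtain ⟨n, hn⟩ := h2.exists
    rw [← hn]
    exact h1 n
  · exact tendsto_integral_of_dominated_convergence g (fun n => (hX n).aestronglyMeasurable) hg
      (fun n => by filter_upwards [hb] with ω h using h n) hlim

theorem tendsto_integral_timeSum {F : ℕ → Bool → ℝ} {C : ℝ}
    (hF : ∀ s a, |F s a| ≤ C * (s + 1)) {T : ℝ} (hT : 0 ≤ T) :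
    Integrable (fun ω => ∫ t in (0 : ℝ)..T, F (stateAt ω t) (π.actionAt ω t)) (σ.law π s₀) ∧
      Tendsto (fun n => ∫ ω, timeSum π F T ω n ∂(σ.law π s₀)) atTop
        (nhds (∫ ω, (∫ t in (0 : ℝ)..T, F (stateAt ω t) (π.actionAt ω t)) ∂(σ.law π s₀))) := by
  have hC : 0 ≤ C := by simpa using (abs_nonneg _).trans (hF 0 true)
  obtain ⟨g, hgi, hg⟩ := σ.exists_integrable_bound_jumpSum π s₀ hT
  refine σ.tendsto_integral_of_eventually_eq π s₀ (g := fun ω => C * (s₀ + g ω + 1) * T)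
    (σ.integrable_timeSum π s₀ F hT)
    (((((integrable_const _).add hgi).add (integrable_const _)).const_mul _).mul_const _) ?_ ?_
  · filter_upwards [σ.ae_regular π s₀, hg] with ω h h1 n
    refine (h.abs_timeSum_le π hF hT n).trans ?_
    have := h1 n
    gcongr
  · filter_upwards [σ.ae_regular π s₀, σ.ae_eventually_lt_eventTime π s₀ hT] with ω h h1
    filter_upwards [h1] with n hn
    exact (h.intervalIntegral_eq_timeSum π F hT hn).symm

theorem tendsto_integral_jumpSum {V : ℕ → ℝ} {K : ℝ} (hV : ∀ s, |V s| ≤ K * (s + 1))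
    {T : ℝ} (hT : 0 ≤ T) :
    Integrable (fun ω => V (stateAt ω T)) (σ.law π s₀) ∧
      Tendsto (fun n => ∫ ω, jumpSum (fun s s' => V s' - V s) T ω n ∂(σ.law π s₀)) atTop
        (nhds (∫ ω, V (stateAt ω T) ∂(σ.law π s₀) - V s₀)) := by
  have hK : 0 ≤ K := by simpa using (abs_nonneg _).trans (hV 0)
  obtain ⟨g, hgi, hg⟩ := σ.exists_integrable_bound_jumpSum π s₀ hT
  have key := σ.tendsto_integral_of_eventually_eq π s₀
    (X := fun n ω => jumpSum (fun s s' => V s' - V s) T ω n)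
    (Y := fun ω => V (stateAt ω T) - V s₀)
    (g := fun ω => K * (s₀ + g ω + 1) + |V s₀|)
    (σ.integrable_jumpSum π s₀ _ T)
    (((((integrable_const _).add hgi).add (integrable_const _)).const_mul _).add
      (integrable_const _)) ?_ ?_
  · have hi : Integrable (fun ω => V (stateAt ω T)) (σ.law π s₀) := by
      refine (key.1.add (integrable_const (V s₀))).congr (.of_forall fun ω => ?_)
      simp
    refine ⟨hi, ?_⟩
    have := key.2
    rw [integral_sub hi (integrable_const _)] at this
    simpa using this
  · filter_upwards [σ.ae_regular π s₀, hg] with ω h h1 n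
    obtain ⟨m, -, -, -, h3, h4⟩ := h.exists_count hT n
    have h5 := h1 n
    rw [h3] at h5
    rw [h4]
    refine (abs_sub _ _).trans (add_le_add_left ((hV _).trans ?_) _)
    have : ((ω m).2 : ℝ) ≤ s₀ + m := by exact_mod_cast h.state_le m
    refine mul_le_mul_of_nonneg_left ?_ hK
    linarith
  · filter_upwards [σ.ae_regular π s₀, σ.ae_eventually_lt_eventTime π s₀ hT] with ω h h1
    filter_upwards [h1] with n hn
    exact h.jumpSum_eq hT hn V

/-- The generator of the controlled queue: the mean rate of change of `V` in the state `s` under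
the action `a`. -/
def generator (V : ℕ → ℝ) (s : ℕ) (a : Bool) : ℝ :=
  σ.lam * (V (s + 1) - V s) + σ.deathRate s a * (V (s - 1) - V s)

theorem abs_le_of_abs_increment_le {V : ℕ → ℝ} {K : ℝ} (hV : ∀ s, |V (s + 1) - V s| ≤ K) (s : ℕ) :
    |V s| ≤ (|V 0| + K) * (s + 1) := by
  have hK : 0 ≤ K := (abs_nonneg _).trans (hV 0)
  have : |V s| ≤ |V 0| + K * s := by
    induction s with
    | zero => simp
    | succ s ih =>
      have h1 := abs_add_le (V (s + 1) - V s) (V s)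
      rw [sub_add_cancel] at h1
      push_cast
      linarith [hV s]
  have h2 : 0 ≤ |V 0| * s := by positivity
  linarith

theorem abs_generator_le {V : ℕ → ℝ} {K : ℝ} (hV : ∀ s, |V (s + 1) - V s| ≤ K) (s : ℕ) (a : Bool) :
    |σ.generator V s a| ≤ (σ.lam + σ.mu) * K * (s + 1) := by
  have hl := σ.lam_pos
  have hm := σ.mu_pos
  have hK : 0 ≤ K := (abs_nonneg _).trans (hV 0)
  have h1 : |V (s - 1) - V s| ≤ K := by
    rcases s with _ | s
    · simpa using hK
    · rw [abs_sub_comm]; exact hV s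
  have h2 : σ.deathRate s a ≤ σ.mu * s := by
    unfold deathRate
    split_ifs
    · exact le_rfl
    · positivity
  calc |σ.generator V s a|
      ≤ σ.lam * |V (s + 1) - V s| + σ.deathRate s a * |V (s - 1) - V s| := by
        refine (abs_add_le _ _).trans ?_
        rw [abs_mul, abs_mul, abs_of_pos hl, abs_of_nonneg (σ.deathRate_nonneg s a)]
    _ ≤ σ.lam * K + σ.mu * s * K := by
        gcongr
        exact hV s
    _ ≤ (σ.lam + σ.mu) * K * (s + 1) := by
        have : 0 ≤ σ.lam * K * s + σ.mu * K := by positivity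
        linarith

/-- Dynkin's formula for functions with bounded increments. -/
theorem dynkin {V : ℕ → ℝ} {K : ℝ} (hV : ∀ s, |V (s + 1) - V s| ≤ K) {T : ℝ} (hT : 0 ≤ T) :
    ∫ ω, V (stateAt ω T) ∂(σ.law π s₀)
      = V s₀ + ∫ ω, (∫ t in (0 : ℝ)..T,
          σ.generator V (stateAt ω t) (π.actionAt ω t)) ∂(σ.law π s₀) := by
  have h1 := (σ.tendsto_integral_jumpSum π s₀ (abs_le_of_abs_increment_le hV) hT).2
  have h2 := (σ.tendsto_integral_timeSum π s₀ (σ.abs_generator_le hV) hT).2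
  simp_rw [σ.integral_jumpSum π s₀ (fun s s' => V s' - V s) hT] at h1
  have := tendsto_nhds_unique h1 h2
  linarith

theorem integrable_stateAt {T : ℝ} (hT : 0 ≤ T) :
    Integrable (fun ω => (stateAt ω T : ℝ)) (σ.law π s₀) :=
  (σ.tendsto_integral_jumpSum π s₀ (V := fun s => (s : ℝ)) (K := 1)
    (fun s => by rw [abs_of_nonneg (Nat.cast_nonneg s)]; linarith) hT).1

/-- The second moment of the queue grows at most at the rate `λ (2 S + 1)`. By Jensen's inequality,
a mean queue length that is not small at time `T` costs an amount quadratic in it. -/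
theorem sq_integral_stateAt_le {T : ℝ} (hT : 0 ≤ T) :
    (∫ ω, (stateAt ω T : ℝ) ∂(σ.law π s₀)) ^ 2 ≤ (s₀ : ℝ) ^ 2
      + ∫ ω, (∫ t in (0 : ℝ)..T, σ.lam * (2 * (stateAt ω t : ℝ) + 1)) ∂(σ.law π s₀) := by
  have hl := σ.lam_pos
  let F : ℕ → Bool → ℝ := fun s _ => σ.lam * (2 * (s : ℝ) + 1)
  have hF : ∀ s a, |F s a| ≤ (2 * σ.lam) * (s + 1) := fun s a => by
    rw [abs_of_nonneg (by positivity)]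
    simp only [F]; linarith
  have h1 := (σ.tendsto_integral_jumpSum π s₀ (V := fun s => (s : ℝ)) (K := 1)
    (fun s => by rw [abs_of_nonneg (Nat.cast_nonneg s)]; linarith) hT).2
  have h2 := (σ.tendsto_integral_timeSum π s₀ hF hT).2
  have h3 := (h1.add_const (s₀ : ℝ)).pow 2
  rw [sub_add_cancel] at h3
  refine le_of_tendsto_of_tendsto' h3 (h2.const_add ((s₀ : ℝ) ^ 2)) fun n => ?_
  have i1 := σ.integrable_jumpSum π s₀ (fun s s' => (s' : ℝ) - s) T n
  have i2 := σ.integrable_jumpSum π s₀ (fun s s' => (s' : ℝ) ^ 2 - (s : ℝ) ^ 2) T n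
  have hsq : ∀ᵐ ω ∂(σ.law π s₀), (jumpSum (fun s s' => (s' : ℝ) - s) T ω n + s₀) ^ 2
      = jumpSum (fun s s' => (s' : ℝ) ^ 2 - (s : ℝ) ^ 2) T ω n + (s₀ : ℝ) ^ 2 := by
    filter_upwards [σ.ae_regular π s₀] with ω h
    obtain ⟨m, -, -, -, -, h4⟩ := h.exists_count hT n
    rw [h4 (fun s => (s : ℝ)), h4 (fun s => (s : ℝ) ^ 2)]
    ring
  have i3 : Integrable (fun ω => (jumpSum (fun s s' => (s' : ℝ) - s) T ω n + s₀) ^ 2)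
      (σ.law π s₀) :=
    (i2.add (integrable_const ((s₀ : ℝ) ^ 2))).congr (hsq.mono fun ω h => h.symm)
  calc (∫ ω, jumpSum (fun s s' => (s' : ℝ) - s) T ω n ∂(σ.law π s₀) + s₀) ^ 2
      = (∫ ω, (jumpSum (fun s s' => (s' : ℝ) - s) T ω n + s₀) ∂(σ.law π s₀)) ^ 2 := by
        rw [integral_add i1 (integrable_const _)]; simp
    _ ≤ ∫ ω, (jumpSum (fun s s' => (s' : ℝ) - s) T ω n + s₀) ^ 2 ∂(σ.law π s₀) :=
        (even_two.convexOn_pow (𝕜 := ℝ)).map_integral_le (continuous_pow 2).continuousOn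
          isClosed_univ (.of_forall fun _ => Set.mem_univ _) (i1.add (integrable_const _)) i3
    _ = ∫ ω, timeSum π (σ.jumpRate fun s s' => (s' : ℝ) ^ 2 - (s : ℝ) ^ 2) T ω n ∂(σ.law π s₀)
          + (s₀ : ℝ) ^ 2 := by
        rw [integral_congr_ae hsq, integral_add i2 (integrable_const _),
          σ.integral_jumpSum π s₀ _ hT]
        simp
    _ ≤ (s₀ : ℝ) ^ 2 + ∫ ω, timeSum π F T ω n ∂(σ.law π s₀) := by
        rw [add_comm]
        refine add_le_add_right (integral_mono_ae (σ.integrable_timeSum π s₀ _ hT n)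
          (σ.integrable_timeSum π s₀ _ hT n) ?_) _
        filter_upwards [σ.ae_regular π s₀] with ω h
        refine Finset.sum_le_sum fun k _ =>
          mul_le_mul_of_nonneg_right ?_ (h.elapsed_nonneg T k)
        generalize (ω k).2 = s
        have h5 : (((s - 1 : ℕ) : ℝ)) ^ 2 - (s : ℝ) ^ 2 ≤ 0 := by
          have : ((s - 1 : ℕ) : ℝ) ≤ s := by exact_mod_cast Nat.sub_le s 1
          have : (0 : ℝ) ≤ ((s - 1 : ℕ) : ℝ) := Nat.cast_nonneg _
          nlinarith
        have h6 := mul_nonpos_of_nonneg_of_nonpos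
          (σ.deathRate_nonneg s (π.actionAfter ω k)) h5
        simp only [jumpRate, F]
        push_cast
        linarith

/-! ### The stationary distributions of the threshold policies -/

/-- The offered load `λ / μ`. -/
def load : ℝ := σ.lam / σ.mu

theorem load_pos : 0 < σ.load := div_pos σ.lam_pos σ.mu_pos

/-- The stationary weight of the state `m + k` relative to `m` when all states above `m` are
active. -/
def weight (m k : ℕ) : ℝ := ∏ i ∈ Finset.range k, σ.load / (m + i + 1)

theorem weight_pos (m k : ℕ) : 0 < σ.weight m k :=
  Finset.prod_pos fun i _ => div_pos σ.load_pos (by positivity)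

theorem weight_zero (m : ℕ) : σ.weight m 0 = 1 := Finset.prod_range_zero _

theorem weight_succ (m k : ℕ) : σ.weight m (k + 1) = σ.weight m k * (σ.load / (m + k + 1)) :=
  Finset.prod_range_succ _ _

theorem weight_succ' (m k : ℕ) :
    σ.weight m (k + 1) = σ.load / (m + 1) * σ.weight (m + 1) k := by
  rw [weight, Finset.prod_range_succ', mul_comm, weight]
  congr 1
  · simp
  · refine Finset.prod_congr rfl fun i _ => ?_
    push_cast
    ring_nf

theorem weight_succ_le (m k : ℕ) : σ.weight (m + 1) k ≤ σ.weight m k := by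
  have := σ.load_pos
  refine Finset.prod_le_prod (fun i _ => by positivity) fun i _ => ?_
  push_cast
  gcongr
  linarith

theorem summable_weight (m : ℕ) : Summable (σ.weight m) := by
  induction m with
  | zero =>
    refine (Real.summable_pow_div_factorial σ.load).congr fun k => ?_
    induction k with
    | zero => simp [weight_zero]
    | succ k ih =>
      rw [weight_succ, ← ih, Nat.factorial_succ, pow_succ]
      push_cast
      field_simp
      ring
  | succ m ih => exact ih.of_nonneg_of_le (fun k => (σ.weight_pos _ k).le) (σ.weight_succ_le m)

/-- The total weight of the states from `m` on, relative to the state `m`. -/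
def totalWeight (m : ℕ) : ℝ := ∑' k, σ.weight m k

theorem totalWeight_eq (m : ℕ) :
    σ.totalWeight m = 1 + σ.load / (m + 1) * σ.totalWeight (m + 1) := by
  rw [totalWeight, (σ.summable_weight m).tsum_eq_zero_add, weight_zero, totalWeight,
    ← tsum_mul_left]
  simp_rw [weight_succ']

theorem one_le_totalWeight (m : ℕ) : 1 ≤ σ.totalWeight m := by
  rw [← σ.weight_zero m]
  exact (σ.summable_weight m).le_tsum 0 fun k _ => (σ.weight_pos m k).le

theorem totalWeight_pos (m : ℕ) : 0 < σ.totalWeight m :=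
  zero_lt_one.trans_le (σ.one_le_totalWeight m)

theorem totalWeight_succ_lt (m : ℕ) : σ.totalWeight (m + 1) < σ.totalWeight m := by
  refine (σ.summable_weight (m + 1)).tsum_lt_tsum (i := 1) (σ.weight_succ_le m) ?_
    (σ.summable_weight m)
  have := σ.load_pos
  rw [weight_succ, weight_succ, weight_zero, weight_zero]
  push_cast
  gcongr
  linarith

/-- The stationary distribution when exactly the states above `m` are effectively active: that of
the threshold policy `m + 1`, and for `m = 0` also that of the threshold policy `0`, since the
action in the empty state is irrelevant to the dynamics. -/
def statDist (m s : ℕ) : ℝ := if s < m then 0 else σ.weight m (s - m) / σ.totalWeight m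

theorem statDist_of_lt {m s : ℕ} (h : s < m) : σ.statDist m s = 0 := if_pos h

theorem statDist_add (m k : ℕ) : σ.statDist m (m + k) = σ.weight m k / σ.totalWeight m := by
  simp [statDist]

theorem statDist_nonneg (m s : ℕ) : 0 ≤ σ.statDist m s := by
  unfold statDist
  split_ifs
  · exact le_rfl
  · exact (div_pos (σ.weight_pos _ _) (σ.totalWeight_pos m)).le

theorem hasSum_statDist_add (m : ℕ) : HasSum (fun k => σ.statDist m (k + m)) 1 := by
  have := (σ.summable_weight m).hasSum.div_const (σ.totalWeight m)
  rw [← totalWeight, div_self (σ.totalWeight_pos m).ne'] at this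
  refine this.congr_fun fun k => ?_
  rw [add_comm, statDist_add]

theorem hasSum_statDist (m : ℕ) : HasSum (σ.statDist m) 1 := by
  rw [← hasSum_nat_add_iff' m, Finset.sum_eq_zero fun s hs =>
    σ.statDist_of_lt (Finset.mem_range.1 hs), sub_zero]
  exact σ.hasSum_statDist_add m

/-- Summing the global balance equations over the states up to `s` gives the balance of the flows
between `s` and `s + 1`. -/
theorem isStationary_iff_detailed (α : ℕ → Bool) (q : ℕ → ℝ) :
    σ.IsStationary α q ↔ (∀ s, 0 ≤ q s) ∧ HasSum q 1 ∧
      ∀ s, σ.lam * q s = σ.deathRate (s + 1) (α (s + 1)) * q (s + 1) := by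
  refine and_congr_right fun _ => and_congr_right fun _ => ⟨fun h s => ?_, fun h s => ?_⟩
  · induction s with
    | zero =>
      have := h 0
      simpa [deathRate] using this
    | succ s ih =>
      have := h (s + 1)
      simp only [Nat.add_eq_zero_iff, one_ne_zero, and_false, if_false,
        Nat.add_sub_cancel] at this
      linarith
  · rcases s with _ | s
    · have := h 0
      simpa [deathRate] using this
    · have h1 := h s
      have h2 := h (s + 1)
      simp only [Nat.add_eq_zero_iff, one_ne_zero, and_false, if_false,
        Nat.add_sub_cancel]
      linarith

theorem deathRate_threshold (R s : ℕ) :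
    σ.deathRate (s + 1) (threshold R (s + 1)) = if s < R - 1 then 0 else σ.mu * (s + 1) := by
  by_cases h : s < R - 1
  · have : ¬ R ≤ s + 1 := by omega
    simp [deathRate, threshold, h, this]
  · have : R ≤ s + 1 := by omega
    simp [deathRate, threshold, h, this]

theorem isStationary_threshold_iff (R : ℕ) (q : ℕ → ℝ) :
    σ.IsStationary (threshold R) q ↔ q = σ.statDist (R - 1) := by
  have hl := σ.lam_pos
  have hm := σ.mu_pos
  rw [isStationary_iff_detailed]
  simp only [deathRate_threshold]
  generalize R - 1 = m
  constructor
  · rintro ⟨-, hsum, hbal⟩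
    have hlow : ∀ s < m, q s = 0 := fun s hs => by
      have := hbal s
      rw [if_pos hs, zero_mul] at this
      exact (mul_eq_zero.1 this).resolve_left hl.ne'
    have hhigh : ∀ k, q (m + k) = q m * σ.weight m k := fun k => by
      induction k with
      | zero => simp [weight_zero]
      | succ k ih =>
        have := hbal (m + k)
        rw [if_neg (by omega), ih] at this
        rw [weight_succ, ← add_assoc, load]
        push_cast at this
        field_simp
        linarith
    have hq : q m * σ.totalWeight m = 1 := by
      rw [← hasSum_nat_add_iff' m, Finset.sum_eq_zero fun s hs =>
        hlow s (Finset.mem_range.1 hs), sub_zero] at hsum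
      have h2 := (σ.summable_weight m).hasSum.mul_left (q m)
      refine h2.unique (hsum.congr_fun fun k => ?_)
      rw [add_comm k m, hhigh]
    ext s
    rcases lt_or_ge s m with h | h
    · rw [hlow s h, σ.statDist_of_lt h]
    · obtain ⟨k, rfl⟩ := Nat.exists_eq_add_of_le h
      rw [hhigh, statDist_add, eq_div_iff (σ.totalWeight_pos m).ne']
      linear_combination σ.weight m k * hq
  · rintro rfl
    refine ⟨σ.statDist_nonneg m, σ.hasSum_statDist m, fun s => ?_⟩
    split_ifs with h
    · rw [σ.statDist_of_lt h]; simp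
    · obtain ⟨k, rfl⟩ := Nat.exists_eq_add_of_le (not_lt.1 h)
      rw [add_assoc, statDist_add, statDist_add, weight_succ, load]
      have := (σ.totalWeight_pos m).ne'
      push_cast
      field_simp

/-- The stationary passive probability of the threshold policy `R`. -/
def passive : ℕ → ℝ
  | 0 => 0
  | m + 1 => 1 / σ.totalWeight m

/-- The average cost of the threshold policy `R`, in closed form: above the state `R - 1` the mean
number of requests being delivered is `λ / μ`. -/
def thresholdCost (R : ℕ) : ℝ := ((R - 1) * σ.passive R + σ.load) / σ.lam

theorem passiveProb_statDist (R : ℕ) : passiveProb (σ.statDist (R - 1)) R = σ.passive R := by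
  rcases R with _ | m
  · simp [passiveProb, passive]
  · rw [passiveProb, Nat.add_sub_cancel, Finset.sum_range_succ, Finset.sum_eq_zero fun s hs =>
      σ.statDist_of_lt (Finset.mem_range.1 hs), zero_add]
    simpa [weight_zero, passive] using σ.statDist_add m 0

theorem hasSum_cost_statDist (R : ℕ) :
    HasSum (fun s => σ.cost s * σ.statDist (R - 1) s) (σ.thresholdCost R) := by
  have hl := σ.lam_pos
  have hm := σ.mu_pos
  have hR : ((R : ℝ) - 1) * σ.passive R = ((R - 1 : ℕ) : ℝ) * (1 / σ.totalWeight (R - 1)) := by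
    rcases R with _ | m
    · simp [passive]
    · simp [passive]
  rw [thresholdCost, hR]
  generalize R - 1 = m
  have key : HasSum (fun s : ℕ => (s : ℝ) * σ.statDist m s)
      (m * (1 / σ.totalWeight m) + σ.load) := by
    rw [← hasSum_nat_add_iff' (m + 1), Finset.sum_range_succ, Finset.sum_eq_zero fun s hs => by
      rw [σ.statDist_of_lt (Finset.mem_range.1 hs), mul_zero]]
    have h0 : σ.statDist m m = 1 / σ.totalWeight m := by
      simpa [weight_zero] using σ.statDist_add m 0
    rw [h0]
    have := (σ.hasSum_statDist_add m).mul_left σ.load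
    convert! this using 1
    · ext k
      have h1 := ((σ.isStationary_threshold_iff (m + 1) (σ.statDist m)).2 rfl)
      rw [isStationary_iff_detailed] at h1
      have h2 := h1.2.2 (k + m)
      rw [deathRate_threshold, if_neg (by omega)] at h2
      rw [load, ← add_assoc]
      push_cast at h2 ⊢
      field_simp
      linarith
    · ring
  convert! key.div_const σ.lam using 1
  ext s
  rw [cost]; ring

theorem passive_le_one (R : ℕ) : σ.passive R ≤ 1 := by
  rcases R with _ | m
  · simp [passive]
  · exact (div_le_one (σ.totalWeight_pos m)).2 (σ.one_le_totalWeight m)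

theorem passive_succ_pos (m : ℕ) : 0 < σ.passive (m + 1) :=
  one_div_pos.2 (σ.totalWeight_pos m)

theorem strictMono_passive : StrictMono σ.passive := by
  refine strictMono_nat_of_lt_succ fun R => ?_
  rcases R with _ | m
  · exact σ.passive_succ_pos 0
  · exact one_div_lt_one_div_of_lt (σ.totalWeight_pos _) (σ.totalWeight_succ_lt m)

theorem passive_rec (m : ℕ) :
    (1 - σ.passive (m + 1)) * σ.passive (m + 2) * (m + 1) = σ.load * σ.passive (m + 1) := by
  have h1 := σ.totalWeight_pos m
  have h2 := σ.totalWeight_pos (m + 1)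
  have h3 := σ.totalWeight_eq m
  simp only [passive]
  have h4 : (σ.totalWeight m - 1) * (m + 1) = σ.load * σ.totalWeight (m + 1) := by
    rw [h3]; field_simp; ring
  field_simp
  linarith

theorem existsUnique_isStationary (R : ℕ) : ∃! p, σ.IsStationary (threshold R) p := by
  simp only [isStationary_threshold_iff]
  exact existsUnique_eq

/-! ### The Lagrangian costs of the threshold policies -/

/-- The average cost of the threshold policy `R` under the subsidy `W`. -/
def lagrangian (W : ℝ) (R : ℕ) : ℝ := σ.thresholdCost R - W * σ.passive R

/-- The ratio that defines the candidate index, in terms of the closed forms. -/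
def ratio (R : ℕ) : ℝ :=
  (σ.thresholdCost (R + 1) - σ.thresholdCost R) / (σ.passive (R + 1) - σ.passive R)

theorem lagrangian_succ_sub (W : ℝ) (R : ℕ) :
    σ.lagrangian W (R + 1) - σ.lagrangian W R
      = (σ.passive (R + 1) - σ.passive R) * (σ.ratio R - W) := by
  have := sub_pos.2 (σ.strictMono_passive R.lt_succ_self)
  rw [ratio, mul_sub, mul_div_cancel₀ _ this.ne', lagrangian, lagrangian]
  ring

theorem lagrangian_succ_le {W : ℝ} {R : ℕ} (h : σ.ratio R ≤ W) :
    σ.lagrangian W (R + 1) ≤ σ.lagrangian W R := by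
  have h1 := sub_pos.2 (σ.strictMono_passive R.lt_succ_self)
  have h2 := σ.lagrangian_succ_sub W R
  nlinarith

theorem lt_lagrangian_succ {W : ℝ} {R : ℕ} (h : W < σ.ratio R) :
    σ.lagrangian W R < σ.lagrangian W (R + 1) := by
  have h1 := sub_pos.2 (σ.strictMono_passive R.lt_succ_self)
  have h2 := σ.lagrangian_succ_sub W R
  have := mul_pos h1 (sub_pos.2 h)
  linarith

theorem thresholdCost_zero : σ.thresholdCost 0 = σ.load / σ.lam := by
  simp [thresholdCost, passive]

theorem thresholdCost_one : σ.thresholdCost 1 = σ.load / σ.lam := by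
  simp [thresholdCost]

theorem ratio_zero : σ.ratio 0 = 0 := by
  rw [ratio, zero_add, thresholdCost_zero, thresholdCost_one, sub_self, zero_div]

/-- The costs of the threshold policies are unbounded while the passive probabilities are at most
one, so the ratios of their increments are unbounded. -/
theorem exists_lt_ratio (W : ℝ) : ∃ R, W < σ.ratio R := by
  by_contra! h
  have hl := σ.lam_pos
  have h1 := σ.passive_succ_pos 0
  have hanti : ∀ R, σ.lagrangian W R ≤ σ.lagrangian W 0 := fun R =>
    antitone_nat_of_succ_le (fun R => σ.lagrangian_succ_le (h R)) (Nat.zero_le R)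
  obtain ⟨n, hn⟩ := exists_nat_gt ((σ.lagrangian W 0 + |W|) * σ.lam / σ.passive 1)
  have h2 := hanti (n + 1)
  have h3 : σ.passive 1 ≤ σ.passive (n + 1) := σ.strictMono_passive.monotone (by omega)
  have h4 : W * σ.passive (n + 1) ≤ |W| := by
    have := σ.passive_succ_pos n
    have := σ.passive_le_one (n + 1)
    calc W * σ.passive (n + 1) ≤ |W| * σ.passive (n + 1) := by gcongr; exact le_abs_self W
      _ ≤ |W| * 1 := by gcongr
      _ = |W| := mul_one _
  have h5 : n * σ.passive 1 / σ.lam ≤ σ.thresholdCost (n + 1) := by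
    rw [thresholdCost]
    have := σ.load_pos
    push_cast
    gcongr
    have : (n : ℝ) * σ.passive 1 ≤ n * σ.passive (n + 1) := by gcongr
    linarith
  rw [zero_add] at h1
  rw [div_lt_iff₀ h1, ← lt_div_iff₀ hl] at hn
  have h6 : σ.lagrangian W (n + 1) = σ.thresholdCost (n + 1) - W * σ.passive (n + 1) := rfl
  linarith

/-! ### The dynamic programming equation -/

/-- The rate `μ s (V(s) - V(s - 1))` at which being active in state `s` reduces the relative value
`V`, for any solution `V` of the dynamic programming equation with constant `f`: the equation in
the state `s` expresses the gain in `s + 1` by that in `s`. -/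
def gain (f W : ℝ) : ℕ → ℝ
  | 0 => 0
  | s + 1 => σ.mu * (s + 1) / σ.lam * (f - σ.cost s + max W (gain f W s))

theorem bellman_false (W : ℝ) (V : ℕ → ℝ) (s : ℕ) :
    σ.bellman W V s false = σ.cost s + σ.lam * (V (s + 1) - V s) - W := by
  simp [bellman, costRate, deathRate]; ring

theorem bellman_true (W : ℝ) (V : ℕ → ℝ) (s : ℕ) :
    σ.bellman W V s true
      = σ.cost s + σ.lam * (V (s + 1) - V s) - σ.mu * s * (V s - V (s - 1)) := by
  simp [bellman, costRate, deathRate]; ring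

/-- The dynamic programming equation determines the increments of its solution from the constant,
without any growth condition. -/
theorem solvesDP_iff (W f : ℝ) (V : ℕ → ℝ) :
    σ.SolvesDP W f V ↔ ∀ s : ℕ, σ.mu * s * (V s - V (s - 1)) = σ.gain f W s := by
  have hl := σ.lam_pos
  have hm := σ.mu_pos
  have hmin : ∀ s, min (σ.bellman W V s false) (σ.bellman W V s true)
      = σ.cost s + σ.lam * (V (s + 1) - V s) - max W (σ.mu * s * (V s - V (s - 1))) := fun s => by
    rw [bellman_false, bellman_true, min_sub_sub_left]
  have hstep : ∀ s : ℕ, σ.mu * s * (V s - V (s - 1)) = σ.gain f W s →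
      (f = min (σ.bellman W V s false) (σ.bellman W V s true) ↔
        σ.mu * (s + 1 : ℕ) * (V (s + 1) - V (s + 1 - 1)) = σ.gain f W (s + 1)) := fun s hs => by
    rw [hmin, hs, gain, Nat.add_sub_cancel]
    push_cast
    have h0 : σ.mu * ((s : ℝ) + 1) ≠ 0 := by positivity
    constructor
    · intro h
      have h1 : f - σ.cost s + max W (σ.gain f W s) = σ.lam * (V (s + 1) - V s) := by linarith
      rw [h1]; field_simp
    · intro h
      have h1 : V (s + 1) - V s = (f - σ.cost s + max W (σ.gain f W s)) / σ.lam :=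
        mul_left_cancel₀ h0 (h.trans (by ring))
      rw [h1, mul_div_cancel₀ _ hl.ne']; ring
  constructor
  · intro h s
    induction s with
    | zero => simp [gain]
    | succ s ih => exact (hstep s ih).1 (h s)
  · exact fun h s => (hstep s (h s)).2 (h (s + 1))

theorem bellman_false_eq_iff {W f : ℝ} {V : ℕ → ℝ} (h : σ.SolvesDP W f V) (s : ℕ) :
    σ.bellman W V s false = f ↔ σ.gain f W s ≤ W := by
  rw [← (σ.solvesDP_iff W f V).1 h s, h s, eq_comm, min_eq_left_iff, bellman_false, bellman_true,
    sub_le_sub_iff_left]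

theorem bellman_true_eq_iff {W f : ℝ} {V : ℕ → ℝ} (h : σ.SolvesDP W f V) (s : ℕ) :
    σ.bellman W V s true = f ↔ W ≤ σ.gain f W s := by
  rw [← (σ.solvesDP_iff W f V).1 h s, h s, eq_comm, min_eq_right_iff, bellman_false, bellman_true,
    sub_le_sub_iff_left]

/-- The solution of the dynamic programming equation with constant `f` that vanishes at `0`. -/
def relValue (f W : ℝ) (s : ℕ) : ℝ :=
  ∑ j ∈ Finset.range s, σ.gain f W (j + 1) / (σ.mu * (j + 1))

theorem relValue_succ_sub (f W : ℝ) (s : ℕ) :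
    σ.relValue f W (s + 1) - σ.relValue f W s = σ.gain f W (s + 1) / (σ.mu * (s + 1)) := by
  rw [relValue, relValue, Finset.sum_range_succ, add_sub_cancel_left]

theorem solvesDP_relValue (f W : ℝ) : σ.SolvesDP W f (σ.relValue f W) := by
  have hm := σ.mu_pos
  rw [solvesDP_iff]
  rintro (_ | s)
  · simp [gain]
  · rw [Nat.add_sub_cancel, relValue_succ_sub]
    push_cast
    field_simp

/-! ### Threshold policies solve the dynamic programming equation -/

/-- The quotients `(E_{s+1} - f) / P_{s+1}` satisfy the recursion of the gain in active states. -/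
theorem thresholdCost_succ_sub (f : ℝ) (s : ℕ) :
    (σ.thresholdCost (s + 2) - f) / σ.passive (s + 2)
      = σ.mu * (s + 1) / σ.lam *
        (f - σ.cost s + (σ.thresholdCost (s + 1) - f) / σ.passive (s + 1)) := by
  have hl := σ.lam_pos
  have hm := σ.mu_pos
  have h1 := σ.passive_succ_pos s
  have h2 := σ.passive_succ_pos (s + 1)
  have h3 := σ.passive_rec s
  have hρ := σ.load_pos
  have key : σ.load * σ.passive (s + 1) * (σ.thresholdCost (s + 2) - f)
      = (s + 1) * σ.passive (s + 2) * ((f - σ.cost s) * σ.passive (s + 1)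
        + (σ.thresholdCost (s + 1) - f)) := by
    simp only [thresholdCost, cost]
    push_cast
    field_simp
    linear_combination (f * σ.lam - σ.load) * h3
  have h4 : σ.mu * (s + 1) / σ.lam = (s + 1) / σ.load := by
    rw [load]; field_simp
  rw [h4]
  field_simp
  linear_combination key

variable {σ} {W : ℝ} {R : ℕ}

theorem lagrangian_le_of_lt (hlow : ∀ s < R, σ.ratio s ≤ W) {s : ℕ} (hs : s ≤ R) :
    σ.lagrangian W R ≤ σ.lagrangian W s := by
  induction R, hs using Nat.le_induction with
  | base => exact le_rfl
  | succ n hn ih =>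
    exact (σ.lagrangian_succ_le (hlow n n.lt_succ_self)).trans
      (ih fun s hs => hlow s (hs.trans n.lt_succ_self))

theorem lagrangian_lt_of_lt (hhigh : ∀ s ≥ R, W < σ.ratio s) {s : ℕ} (hs : R < s) :
    σ.lagrangian W R < σ.lagrangian W s := by
  induction s, hs using Nat.le_induction with
  | base => exact σ.lt_lagrangian_succ (hhigh R le_rfl)
  | succ n hn ih => exact ih.trans (σ.lt_lagrangian_succ (hhigh n (by omega)))

/-- Below the threshold, the gain from being active does not exceed the subsidy because the
Lagrangian costs decrease up to the optimal threshold. -/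
theorem gain_le (hlow : ∀ s < R, σ.ratio s ≤ W) {s : ℕ} (hs : s < R) :
    σ.gain (σ.lagrangian W R) W s ≤ W := by
  have hl := σ.lam_pos
  have hm := σ.mu_pos
  induction s with
  | zero => simpa [gain, ratio_zero] using hlow 0 hs
  | succ s ih =>
    set f := σ.lagrangian W R with hf
    rw [gain, max_eq_left (ih (by omega))]
    have h1 : σ.lagrangian W (s + 2) ≤ σ.lagrangian W (s + 1) :=
      σ.lagrangian_succ_le (hlow (s + 1) hs)
    have h2 : f ≤ σ.lagrangian W (s + 2) := lagrangian_le_of_lt hlow hs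
    have h3 := σ.passive_succ_pos s
    have h4 := σ.passive_le_one (s + 1)
    have h5 := σ.passive_rec s
    -- The excess costs of the thresholds `s + 1` and `s + 2` are `a ≥ b ≥ 0`; hence
    -- `a ≥ (1 - P_{s+1}) b`, and that is the claim in view of the recursion for `P`.
    have h6 : (1 - σ.passive (s + 1)) * (σ.lagrangian W (s + 2) - f)
        ≤ σ.lagrangian W (s + 1) - f := by nlinarith
    have h7 : σ.lagrangian W (s + 1) - f
        - (1 - σ.passive (s + 1)) * (σ.lagrangian W (s + 2) - f)
        = σ.passive (s + 1) * (σ.cost s - W - f + W * σ.load / (s + 1)) := by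
      have h8 : (1 - σ.passive (s + 1)) * σ.passive (s + 2)
          = σ.load * σ.passive (s + 1) / (s + 1) := by
        rw [eq_div_iff (by positivity), h5]
      simp only [lagrangian, thresholdCost, cost]
      push_cast
      field_simp at h8 ⊢
      linear_combination (- ((s : ℝ) + 1) + W * σ.lam) * h8
    have h8 : 0 ≤ σ.cost s - W - f + W * σ.load / (s + 1) := by
      refine nonneg_of_mul_nonneg_right ?_ h3
      linarith
    have h9 : f - σ.cost s + W ≤ W * σ.load / (s + 1) := by linarith
    calc σ.mu * (s + 1) / σ.lam * (f - σ.cost s + W)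
        ≤ σ.mu * (s + 1) / σ.lam * (W * σ.load / (s + 1)) := by gcongr
      _ = W := by rw [load]; field_simp

/-- From the threshold on, the gain exceeds the subsidy because the threshold policy `s + 1` has a
larger Lagrangian cost than the optimal one. -/
theorem gain_eq (hlow : ∀ s < R, σ.ratio s ≤ W) (hhigh : ∀ s ≥ R, W < σ.ratio s) {s : ℕ}
    (hs : R ≤ s) :
    σ.gain (σ.lagrangian W R) W s
        = (σ.thresholdCost (s + 1) - σ.lagrangian W R) / σ.passive (s + 1) ∧
      W < σ.gain (σ.lagrangian W R) W s := by
  have hpos : ∀ s ≥ R, W < (σ.thresholdCost (s + 1) - σ.lagrangian W R) / σ.passive (s + 1) := by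
    intro s hs
    have := lagrangian_lt_of_lt hhigh (show R < s + 1 by omega)
    rw [lt_div_iff₀ (σ.passive_succ_pos s)]
    rw [lagrangian.eq_1 σ W (s + 1)] at this
    linarith
  suffices h : σ.gain (σ.lagrangian W R) W s
        = (σ.thresholdCost (s + 1) - σ.lagrangian W R) / σ.passive (s + 1) from
    ⟨h, h ▸ hpos s hs⟩
  induction s, hs using Nat.le_induction with
  | base =>
    rcases R with _ | r
    · simp [gain, lagrangian, passive, thresholdCost_zero, thresholdCost_one]
    · rw [gain, max_eq_left (gain_le hlow r.lt_succ_self), thresholdCost_succ_sub]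
      congr 2
      rw [eq_div_iff (σ.passive_succ_pos r).ne', lagrangian]
      ring
  | succ s hs ih =>
    rw [gain, max_eq_right (by rw [ih]; exact (hpos s hs).le), ih, ← thresholdCost_succ_sub]

theorem exists_abs_le_of_eventually {g : ℕ → ℝ} {C : ℝ} {N : ℕ} (h : ∀ s ≥ N, |g s| ≤ C) :
    ∃ K, ∀ s, |g s| ≤ K := by
  refine ⟨∑ s ∈ Finset.range N, |g s| + |C|, fun s => ?_⟩
  rcases lt_or_ge s N with hs | hs
  · have := Finset.single_le_sum (f := fun s => |g s|) (fun _ _ => abs_nonneg _)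
      (Finset.mem_range.2 hs)
    have := abs_nonneg C
    linarith
  · have : 0 ≤ ∑ s ∈ Finset.range N, |g s| := Finset.sum_nonneg fun _ _ => abs_nonneg _
    linarith [h s hs, le_abs_self C]

/-- The relative value grows at most linearly, as the gain in `s` is of order `s`. -/
theorem exists_abs_relValue_succ_sub_le (hlow : ∀ s < R, σ.ratio s ≤ W)
    (hhigh : ∀ s ≥ R, W < σ.ratio s) :
    ∃ K, ∀ s, |σ.relValue (σ.lagrangian W R) W (s + 1) - σ.relValue (σ.lagrangian W R) W s|
      ≤ K := by
  have hl := σ.lam_pos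
  have hm := σ.mu_pos
  have hρ := σ.load_pos
  set f := σ.lagrangian W R with hf
  have hp := σ.passive_succ_pos 0
  refine exists_abs_le_of_eventually (N := R)
    (C := ((1 + σ.load) / σ.lam + |f|) / (σ.passive 1 * σ.mu)) fun s hs => ?_
  have h1 := (gain_eq hlow hhigh (show R ≤ s + 1 by omega)).1
  rw [relValue_succ_sub, h1, ← hf, abs_div, abs_div, abs_of_pos (σ.passive_succ_pos _),
    abs_of_pos (show 0 < σ.mu * ((s : ℝ) + 1) by positivity)]
  have h2 : |σ.thresholdCost (s + 1 + 1) - f| ≤ ((1 + σ.load) / σ.lam + |f|) * (s + 1) := by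
    have h3 := σ.passive_succ_pos (s + 1)
    have h4 := σ.passive_le_one (s + 1 + 1)
    have h5 : 0 ≤ σ.thresholdCost (s + 1 + 1) := by
      rw [thresholdCost]; push_cast
      have : 0 ≤ ((s : ℝ) + 1 + 1 - 1) := by linarith [(Nat.cast_nonneg s : (0 : ℝ) ≤ s)]
      positivity
    have h6 : σ.thresholdCost (s + 1 + 1) ≤ (1 + σ.load) / σ.lam * (s + 1) := by
      rw [thresholdCost, div_mul_eq_mul_div]
      push_cast
      gcongr
      have : ((s : ℝ) + 1) * σ.passive (s + 1 + 1) ≤ (s + 1) * 1 := by gcongr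
      have : 0 ≤ σ.load * s := by positivity
      linarith
    have h7 : |f| ≤ |f| * (s + 1) := le_mul_of_one_le_right (abs_nonneg _)
      (by linarith [(Nat.cast_nonneg s : (0 : ℝ) ≤ s)])
    refine (abs_sub _ _).trans ?_
    rw [abs_of_nonneg h5]
    linarith
  have h3 : σ.passive 1 ≤ σ.passive (s + 1 + 1) := σ.strictMono_passive.monotone (by omega)
  have h4 := σ.passive_succ_pos (s + 1)
  rw [zero_add] at hp
  rw [div_div, div_le_div_iff₀ (by positivity) (by positivity)]
  calc |σ.thresholdCost (s + 1 + 1) - f| * (σ.passive 1 * σ.mu)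
      ≤ (((1 + σ.load) / σ.lam + |f|) * (s + 1)) * (σ.passive (s + 1 + 1) * σ.mu) := by gcongr
    _ = _ := by ring

/-- The relative value is bounded below, as it increases once the threshold cost exceeds the
minimal cost. -/
theorem exists_le_relValue (hlow : ∀ s < R, σ.ratio s ≤ W) (hhigh : ∀ s ≥ R, W < σ.ratio s) :
    ∃ B, ∀ s, B ≤ σ.relValue (σ.lagrangian W R) W s := by
  have hl := σ.lam_pos
  have hm := σ.mu_pos
  have hρ := σ.load_pos
  set f := σ.lagrangian W R with hf
  have hp := σ.passive_succ_pos 0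
  rw [zero_add] at hp
  obtain ⟨N, hN⟩ := exists_nat_gt (f * σ.lam / σ.passive 1)
  set M := max N R with hM
  have hstep : ∀ s ≥ M, σ.relValue f W s ≤ σ.relValue f W (s + 1) := fun s hs => by
    rw [← sub_nonneg, relValue_succ_sub, (gain_eq hlow hhigh (show R ≤ s + 1 by omega)).1]
    have h3 : σ.passive 1 ≤ σ.passive (s + 1 + 1) := σ.strictMono_passive.monotone (by omega)
    have h4 := σ.passive_succ_pos (s + 1)
    have h5 : f ≤ σ.thresholdCost (s + 1 + 1) := by
      rw [div_lt_iff₀ hp] at hN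
      rw [thresholdCost, le_div_iff₀ hl]
      push_cast
      have : (N : ℝ) ≤ s + 1 := by exact_mod_cast (show N ≤ s + 1 by omega)
      have : N * σ.passive 1 ≤ (s + 1) * σ.passive (s + 1 + 1) := by gcongr
      linarith
    have := sub_nonneg.2 h5
    positivity
  refine ⟨-∑ s ∈ Finset.range (M + 1), |σ.relValue f W s|, fun s => ?_⟩
  have hle : ∀ s ≤ M, -∑ s ∈ Finset.range (M + 1), |σ.relValue f W s| ≤ σ.relValue f W s :=
    fun s hs => by
      have := Finset.single_le_sum (f := fun s => |σ.relValue f W s|) (fun _ _ => abs_nonneg _)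
        (Finset.mem_range.2 (Nat.lt_succ_of_le hs))
      linarith [neg_abs_le (σ.relValue f W s)]
  rcases le_total s M with hs | hs
  · exact hle s hs
  · induction s, hs using Nat.le_induction with
    | base => exact hle M le_rfl
    | succ n hn ih => exact ih.trans (hstep n hn)

end Service

namespace Service

variable (σ : Service) (π : Policy) (s₀ : ℕ)

/-! ### Verification of the dynamic programming equation -/

/-- The mean of `∫_0^T F(S(t), A(t)) dt`. -/
def meanIntegral (F : ℕ → Bool → ℝ) (T : ℝ) : ℝ :=
  ∫ ω, (∫ t in (0 : ℝ)..T, F (stateAt ω t) (π.actionAt ω t)) ∂(σ.law π s₀)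

variable {F G : ℕ → Bool → ℝ} {C D T : ℝ}

theorem meanIntegral_add (hF : ∀ s a, |F s a| ≤ C * (s + 1)) (hG : ∀ s a, |G s a| ≤ D * (s + 1))
    (hT : 0 ≤ T) :
    σ.meanIntegral π s₀ (fun s a => F s a + G s a) T
      = σ.meanIntegral π s₀ F T + σ.meanIntegral π s₀ G T := by
  have hFG : ∀ s a, |F s a + G s a| ≤ (C + D) * (s + 1) := fun s a => by
    rw [add_mul]
    exact (abs_add_le _ _).trans (add_le_add (hF s a) (hG s a))
  refine tendsto_nhds_unique (σ.tendsto_integral_timeSum π s₀ hFG hT).2 ?_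
  refine ((σ.tendsto_integral_timeSum π s₀ hF hT).2.add
    (σ.tendsto_integral_timeSum π s₀ hG hT).2).congr fun n => ?_
  rw [← integral_add (σ.integrable_timeSum π s₀ F hT n) (σ.integrable_timeSum π s₀ G hT n)]
  congr with ω
  simp only [timeSum, add_mul, Finset.sum_add_distrib]

theorem meanIntegral_mono (hF : ∀ s a, |F s a| ≤ C * (s + 1)) (hG : ∀ s a, |G s a| ≤ D * (s + 1))
    (hT : 0 ≤ T) (h : ∀ s a, F s a ≤ G s a) :
    σ.meanIntegral π s₀ F T ≤ σ.meanIntegral π s₀ G T := by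
  refine le_of_tendsto_of_tendsto' (σ.tendsto_integral_timeSum π s₀ hF hT).2
    (σ.tendsto_integral_timeSum π s₀ hG hT).2 fun n => ?_
  refine integral_mono_ae (σ.integrable_timeSum π s₀ F hT n)
    (σ.integrable_timeSum π s₀ G hT n) ?_
  filter_upwards [σ.ae_regular π s₀] with ω hω
  exact Finset.sum_le_sum fun k _ => mul_le_mul_of_nonneg_right (h _ _) (hω.elapsed_nonneg T k)

theorem meanIntegral_const (c : ℝ) : σ.meanIntegral π s₀ (fun _ _ => c) T = c * T := by
  simp [meanIntegral, mul_comm]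

theorem meanIntegral_const_mul (c : ℝ) :
    σ.meanIntegral π s₀ (fun s a => c * F s a) T = c * σ.meanIntegral π s₀ F T := by
  simp [meanIntegral, intervalIntegral.integral_const_mul, integral_const_mul]

theorem avgCost_eq (W : ℝ) : σ.avgCost W π s₀
    = limsup (fun T : ℝ => ((T⁻¹ * σ.meanIntegral π s₀ (σ.costRate W) T : ℝ) : EReal)) atTop :=
  rfl

theorem abs_costRate_le (W : ℝ) (s : ℕ) (a : Bool) :
    |σ.costRate W s a| ≤ (1 / σ.lam + |W|) * (s + 1) := by
  have hl := σ.lam_pos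
  have h1 : |if a then (0 : ℝ) else W| ≤ |W| := by split_ifs <;> simp
  have h2 : |σ.cost s| ≤ 1 / σ.lam * (s + 1) := by
    rw [cost, abs_of_nonneg (by positivity), div_mul_eq_mul_div, one_mul]
    gcongr
    linarith
  have h3 : |W| ≤ |W| * (s + 1) := le_mul_of_one_le_right (abs_nonneg _)
    (by linarith [(Nat.cast_nonneg s : (0 : ℝ) ≤ s)])
  refine (abs_sub _ _).trans ?_
  rw [add_mul]
  linarith

theorem costRate_add_generator (W : ℝ) (V : ℕ → ℝ) (s : ℕ) (a : Bool) :
    σ.costRate W s a + σ.generator V s a = σ.bellman W V s a := by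
  rw [generator, bellman]; ring

variable {W f K : ℝ} {V : ℕ → ℝ}

theorem abs_bellman_le (hV : ∀ s, |V (s + 1) - V s| ≤ K) (s : ℕ) (a : Bool) :
    |σ.bellman W V s a| ≤ (1 / σ.lam + |W| + (σ.lam + σ.mu) * K) * (s + 1) := by
  rw [← costRate_add_generator, add_mul]
  exact (abs_add_le _ _).trans (add_le_add (σ.abs_costRate_le W s a) (σ.abs_generator_le hV s a))

/-- Dynkin's formula as a cost identity: the cost differs from the integral of the Bellman
expression by the change of the relative value. -/
theorem meanIntegral_costRate (hV : ∀ s, |V (s + 1) - V s| ≤ K) (hT : 0 ≤ T) :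
    σ.meanIntegral π s₀ (σ.costRate W) T
      = σ.meanIntegral π s₀ (σ.bellman W V) T + V s₀ - ∫ ω, V (stateAt ω T) ∂(σ.law π s₀) := by
  have h1 := σ.meanIntegral_add π s₀ (σ.abs_costRate_le W) (σ.abs_generator_le hV) hT
  simp only [costRate_add_generator] at h1
  have h2 := σ.dynkin π s₀ hV hT
  change _ = V s₀ + σ.meanIntegral π s₀ (σ.generator V) T at h2
  change σ.meanIntegral π s₀ (σ.bellman W V) T = _ at h1
  linarith

/-- A stationary policy that attains the minimum in the dynamic programming equation costs at
most the constant `f`, provided that the relative value is bounded below. -/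
theorem avgCost_stationary_le {α : ℕ → Bool} {B : ℝ} (hV : ∀ s, |V (s + 1) - V s| ≤ K)
    (hB : ∀ s, B ≤ V s) (hα : ∀ s, σ.bellman W V s (α s) = f) :
    σ.avgCost W (Policy.stationary α) s₀ ≤ f := by
  rw [avgCost_eq]
  have hlim : Tendsto (fun T : ℝ => f + T⁻¹ * (V s₀ - B)) atTop (nhds f) := by
    simpa using (tendsto_inv_atTop_zero.mul_const (V s₀ - B)).const_add f
  have hlim' := (continuous_coe_real_ereal.tendsto f).comp hlim
  rw [← hlim'.limsup_eq]
  refine limsup_le_limsup ?_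
  filter_upwards [eventually_gt_atTop 0] with T hT
  refine EReal.coe_le_coe ?_
  have h1 := σ.meanIntegral_costRate (Policy.stationary α) s₀ (W := W) hV hT.le
  have h2 : σ.meanIntegral (Policy.stationary α) s₀ (σ.bellman W V) T = f * T := by
    rw [← σ.meanIntegral_const (Policy.stationary α) s₀ f]
    unfold meanIntegral
    congr with ω
    congr with t
    exact hα _
  have h3 : B ≤ ∫ ω, V (stateAt ω T) ∂(σ.law (Policy.stationary α) s₀) := by
    have := integral_mono (μ := σ.law (Policy.stationary α) s₀) (integrable_const B)
      (σ.tendsto_integral_jumpSum (Policy.stationary α) s₀ (abs_le_of_abs_increment_le hV) hT.le).1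
      fun ω => hB _
    simpa using this
  rw [h1, h2]
  calc T⁻¹ * (f * T + V s₀ - ∫ ω, V (stateAt ω T) ∂(σ.law (Policy.stationary α) s₀))
      ≤ T⁻¹ * (f * T + V s₀ - B) := by gcongr
    _ = f + T⁻¹ * (V s₀ - B) := by field_simp; ring

/-- No linear lower bound with a positive slope is compatible with a linear bound on the
square. -/
theorem eventually_not_sq_le (ε : ℝ) (hε : 0 < ε) (D A B : ℝ) :
    ∀ᶠ T : ℝ in atTop, ∀ m : ℝ, ε * T - D ≤ m → ¬ m ^ 2 ≤ A + B * T := by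
  filter_upwards [eventually_ge_atTop 1, eventually_ge_atTop (2 * |D| / ε),
    eventually_gt_atTop (4 * (|A| + |B|) / ε ^ 2)] with T h1 h2 h3 m hm hsq
  rw [div_le_iff₀ hε] at h2
  rw [div_lt_iff₀ (by positivity)] at h3
  have h4 : ε * T / 2 ≤ m := by linarith [le_abs_self D]
  have h5 : (ε * T / 2) ^ 2 ≤ m ^ 2 := by gcongr
  have h6 : A ≤ |A| * T := (le_abs_self A).trans (le_mul_of_one_le_right (abs_nonneg _) h1)
  have h7 : B * T ≤ |B| * T := by gcongr; exact le_abs_self B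
  have h8 : (|A| + |B|) * T * 4 < T * ε ^ 2 * T := by nlinarith
  nlinarith

/-- The constant of a solution of the dynamic programming equation with bounded increments is a
lower bound for the average cost of every policy. If the cost stayed below it, the relative value
and hence the mean queue length would grow linearly, and the cost would be quadratic. -/
theorem le_avgCost (hV : ∀ s, |V (s + 1) - V s| ≤ K) (hf : ∀ s a, f ≤ σ.bellman W V s a) :
    (f : EReal) ≤ σ.avgCost W π s₀ := by
  by_contra! hlt
  rw [avgCost_eq] at hlt
  obtain ⟨c, hc1, hc2⟩ := EReal.lt_iff_exists_real_btwn.1 hlt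
  have hc : c < f := EReal.coe_lt_coe_iff.1 hc2
  have hev := eventually_lt_of_limsup_lt hc1
  have hl := σ.lam_pos
  have hVb := abs_le_of_abs_increment_le hV
  set L : ℝ := |V 0| + K + 1 with hL
  have hK : 0 ≤ K := (abs_nonneg _).trans (hV 0)
  have hLpos : 0 < L := by positivity
  have hε : 0 < (f - c) / L := div_pos (sub_pos.2 hc) hLpos
  obtain ⟨T, ⟨hT1, hT2⟩, hT3⟩ := ((hev.and (eventually_gt_atTop 0)).and
    (eventually_not_sq_le _ hε (1 - V s₀ / L) ((s₀ : ℝ) ^ 2)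
      (σ.lam + 2 * σ.lam ^ 2 * (c + |W|)))).exists
  have hJ : σ.meanIntegral π s₀ (σ.costRate W) T < c * T := by
    have := EReal.coe_lt_coe_iff.1 hT1
    rwa [inv_mul_lt_iff₀ hT2, mul_comm] at this
  set m : ℝ := ∫ ω, (stateAt ω T : ℝ) ∂(σ.law π s₀) with hm
  refine hT3 m ?_ ?_
  -- The relative value makes up for the cost below `f T` and is at most `L (S + 1)`.
  · have h1 := σ.meanIntegral_costRate π s₀ (W := W) hV hT2.le
    have h2 : f * T ≤ σ.meanIntegral π s₀ (σ.bellman W V) T := by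
      rw [← σ.meanIntegral_const π s₀ f]
      refine σ.meanIntegral_mono π s₀ (C := |f|) (fun s _ => ?_) (σ.abs_bellman_le hV) hT2.le hf
      exact le_mul_of_one_le_right (abs_nonneg _)
        (by linarith [(Nat.cast_nonneg s : (0 : ℝ) ≤ s)])
    have h3 : ∫ ω, V (stateAt ω T) ∂(σ.law π s₀) ≤ L * (m + 1) := by
      have hi := σ.integrable_stateAt π s₀ hT2.le
      have : L * (m + 1) = ∫ ω, L * ((stateAt ω T : ℝ) + 1) ∂(σ.law π s₀) := by
        rw [integral_const_mul, integral_add hi (integrable_const _)]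
        simp [hm]
      rw [this]
      refine integral_mono (σ.tendsto_integral_jumpSum π s₀ hVb hT2.le).1
        ((hi.add (integrable_const _)).const_mul _) fun ω => ?_
      refine (le_abs_self _).trans ((hVb _).trans ?_)
      have : |V 0| + K ≤ L := by linarith
      exact mul_le_mul_of_nonneg_right this (by positivity)
    have h4 : (f - c) * T + V s₀ ≤ L * (m + 1) := by linarith
    have h5 : (f - c) / L * T - (1 - V s₀ / L) = ((f - c) * T + V s₀) / L - 1 := by
      field_simp; ring
    rw [h5, sub_le_iff_le_add, div_le_iff₀ hLpos]
    linarith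
  -- Up to a constant, the drift `λ (2 S + 1)` of `S ^ 2` is `2 λ ^ 2` times the cost rate.
  · have h1 := σ.sq_integral_stateAt_le π s₀ hT2.le
    let F : ℕ → Bool → ℝ := fun s _ => σ.lam * (2 * (s : ℝ) + 1)
    have hF : ∀ s a, |F s a| ≤ (2 * σ.lam) * (s + 1) := fun s a => by
      rw [abs_of_nonneg (by positivity)]
      simp only [F]; linarith
    have hG : ∀ s a, |(2 * σ.lam ^ 2) * σ.costRate W s a|
        ≤ (2 * σ.lam ^ 2 * (1 / σ.lam + |W|)) * (s + 1) := fun s a => by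
      rw [abs_mul, abs_of_pos (by positivity), mul_assoc (2 * σ.lam ^ 2)]
      gcongr
      exact σ.abs_costRate_le W s a
    have hc : ∀ (s : ℕ) (_ : Bool), abs (σ.lam + 2 * σ.lam ^ 2 * |W|)
        ≤ (σ.lam + 2 * σ.lam ^ 2 * |W|) * (s + 1) := fun s _ => by
      rw [abs_of_nonneg (by positivity)]
      exact le_mul_of_one_le_right (by positivity)
        (by linarith [(Nat.cast_nonneg s : (0 : ℝ) ≤ s)])
    have hsum : ∀ s a, abs ((2 * σ.lam ^ 2) * σ.costRate W s a + (σ.lam + 2 * σ.lam ^ 2 * |W|))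
        ≤ (2 * σ.lam ^ 2 * (1 / σ.lam + |W|) + (σ.lam + 2 * σ.lam ^ 2 * |W|)) * (s + 1) :=
      fun s a => by
        rw [add_mul]
        exact (abs_add_le _ _).trans (add_le_add (hG s a) (hc s a))
    have h2 := σ.meanIntegral_mono π s₀ hF hsum hT2.le fun s a => by
      have : (if a then (0 : ℝ) else W) ≤ |W| := by
        split_ifs
        · exact abs_nonneg W
        · exact le_abs_self W
      have h5 : 2 * σ.lam ^ 2 * (s / σ.lam - |W|) ≤ 2 * σ.lam ^ 2 * σ.costRate W s a := by
        rw [costRate, cost]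
        gcongr
      have h6 : 2 * σ.lam ^ 2 * (s / σ.lam - |W|)
          = 2 * σ.lam * s - 2 * σ.lam ^ 2 * |W| := by field_simp
      simp only [F]
      linarith
    rw [σ.meanIntegral_add π s₀ hG hc hT2.le,
      σ.meanIntegral_const_mul π s₀ (F := σ.costRate W), meanIntegral_const] at h2
    have h3 : 2 * σ.lam ^ 2 * σ.meanIntegral π s₀ (σ.costRate W) T ≤ 2 * σ.lam ^ 2 * (c * T) := by
      gcongr
    change m ^ 2 ≤ (s₀ : ℝ) ^ 2 + σ.meanIntegral π s₀ F T at h1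
    linarith

/-! ### The passive sets and the Whittle index -/

/-- The first threshold at which the ratio exceeds the subsidy is optimal. -/
theorem isOptimal_threshold {R : ℕ} (hlow : ∀ s < R, σ.ratio s ≤ W)
    (hhigh : ∀ s ≥ R, W < σ.ratio s) :
    (∀ s₀, σ.avgCost W (Policy.stationary (threshold R)) s₀ = σ.lagrangian W R ∧
      ∀ π : Policy, σ.lagrangian W R ≤ σ.avgCost W π s₀) ∧
    ∀ s, σ.bellman W (σ.relValue (σ.lagrangian W R) W) s (threshold R s) = σ.lagrangian W R := by
  obtain ⟨K, hK⟩ := exists_abs_relValue_succ_sub_le hlow hhigh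
  obtain ⟨B, hB⟩ := exists_le_relValue hlow hhigh
  have hdp := σ.solvesDP_relValue (σ.lagrangian W R) W
  have hle : ∀ (s₀ : ℕ) (π : Policy), σ.lagrangian W R ≤ σ.avgCost W π s₀ := fun s₀ π =>
    σ.le_avgCost π s₀ hK fun s a => by
      rcases a
      · exact (hdp s).trans_le (min_le_left _ _)
      · exact (hdp s).trans_le (min_le_right _ _)
  have hα : ∀ s, σ.bellman W (σ.relValue (σ.lagrangian W R) W) s (threshold R s)
      = σ.lagrangian W R := fun s => by
    by_cases hs : R ≤ s
    · rw [threshold, decide_eq_true hs, σ.bellman_true_eq_iff hdp]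
      exact (gain_eq hlow hhigh hs).2.le
    · rw [threshold, decide_eq_false hs, σ.bellman_false_eq_iff hdp]
      exact gain_le hlow (not_le.1 hs)
  exact ⟨fun s₀ => ⟨le_antisymm (σ.avgCost_stationary_le s₀ hK hB hα) (hle s₀ _), hle s₀⟩, hα⟩

/-- The passive set is determined by the ratios. A state with a larger ratio is excluded for every
relative value, since the dynamic programming equation determines the gain. -/
theorem passiveSet_eq (hmono : Monotone σ.ratio) (W : ℝ) :
    σ.passiveSet W = {s | σ.ratio s ≤ W} := by
  classical
  let R := Nat.find (σ.exists_lt_ratio W)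
  have hlow : ∀ s < R, σ.ratio s ≤ W := fun s hs => not_lt.1 (Nat.find_min _ hs)
  have hhigh : ∀ s ≥ R, W < σ.ratio s := fun s hs =>
    (Nat.find_spec (σ.exists_lt_ratio W)).trans_le (hmono hs)
  obtain ⟨hopt, hα⟩ := σ.isOptimal_threshold hlow hhigh
  ext s
  constructor
  · rintro ⟨α, ⟨f, V, havg, hdp, hV⟩, hs⟩
    have hf : f = σ.lagrangian W R := by
      refine le_antisymm ?_ ?_
      · exact EReal.coe_le_coe_iff.1 (((havg 0).2 _).trans_eq (hopt 0).1)
      · exact EReal.coe_le_coe_iff.1 (((hopt 0).2 _).trans_eq (havg 0).1)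
    have h1 := hV s
    rw [hs, σ.bellman_false_eq_iff hdp, hf] at h1
    by_contra hlt
    have hRs : R ≤ s := not_lt.1 fun h => hlt (hlow s h)
    exact absurd h1 (not_le.2 (gain_eq hlow hhigh hRs).2)
  · intro hs
    have hsR : ¬ R ≤ s := fun h => absurd (hhigh s h) (not_lt.2 hs)
    exact ⟨threshold R, ⟨σ.lagrangian W R, σ.relValue (σ.lagrangian W R) W, hopt,
      σ.solvesDP_relValue _ _, hα⟩, decide_eq_false hsR⟩

theorem indexRatio_eq_ratio {q : ℕ → ℕ → ℝ}
    (hq : ∀ R, σ.IsStationary (threshold R) (q R)) : σ.indexRatio q = σ.ratio := by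
  have hq' : ∀ R, q R = σ.statDist (R - 1) := fun R =>
    (σ.isStationary_threshold_iff R _).1 (hq R)
  have hc : ∀ R, σ.meanCost (q R) = σ.thresholdCost R := fun R => by
    rw [hq' R]; exact (σ.hasSum_cost_statDist R).tsum_eq
  have hp : ∀ R, passiveProb (q R) R = σ.passive R := fun R => by
    rw [hq' R, passiveProb_statDist]
  ext R
  rw [indexRatio, ratio, hc, hc, hp, hp]

end Service
end ServicePlacement

end

theorem mainTheorem2 (σ : ServicePlacement.Service) :
    (∀ R, ∃! p, σ.IsStationary (ServicePlacement.threshold R) p) ∧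
    ∀ q : ℕ → ℕ → ℝ, (∀ R, σ.IsStationary (ServicePlacement.threshold R) (q R)) →
      (∀ R, Summable fun s => σ.cost s * q R s) ∧
      (∀ R, ServicePlacement.passiveProb (q R) R
        < ServicePlacement.passiveProb (q (R + 1)) (R + 1)) ∧
      (Monotone (σ.indexRatio q) →
        σ.Indexable ∧
        ∀ R, {W : ℝ | 0 ≤ W ∧ R ∈ σ.passiveSet W}.Nonempty ∧
          σ.whittleIndex R = σ.indexRatio q R) := by
  refine ⟨σ.existsUnique_isStationary, fun q hq => ⟨fun R => ?_, fun R => ?_, fun hmono => ?_⟩⟩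
  · rw [(σ.isStationary_threshold_iff R _).1 (hq R)]
    exact (σ.hasSum_cost_statDist R).summable
  · rw [(σ.isStationary_threshold_iff R _).1 (hq R),
      (σ.isStationary_threshold_iff (R + 1) _).1 (hq (R + 1)), σ.passiveProb_statDist,
      σ.passiveProb_statDist]
    exact σ.strictMono_passive R.lt_succ_self
  · rw [σ.indexRatio_eq_ratio hq] at hmono ⊢
    refine ⟨fun W W' hW s hs => ?_, fun R => ?_⟩
    · rw [σ.passiveSet_eq hmono] at hs ⊢
      exact le_trans hs hW
    · have h0 : 0 ≤ σ.ratio R := σ.ratio_zero ▸ hmono R.zero_le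
      have hset : {W : ℝ | 0 ≤ W ∧ R ∈ σ.passiveSet W} = Set.Ici (σ.ratio R) := by
        ext W
        rw [Set.mem_ofPred_eq, σ.passiveSet_eq hmono]
        exact ⟨fun h => h.2, fun h => ⟨h0.trans h, h⟩⟩
      rw [ServicePlacement.Service.whittleIndex, hset]
      exact ⟨Set.nonempty_Ici, csInf_Ici⟩
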